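/- Fix one of the two categories, smooth ($C^\infty$) or real-analytic; all objects below belong to it. Let $1\le k\le n$, let $\omega$ and $\tilde\omega$ be germs at $0$ of symplectic forms (closed nondegenerate $2$-forms) on $\mathbb R^{2n}$, and let $S_1, S_2$ be germs at $0$ of $k$-dimensional embedded submanifolds of $\mathbb R^{2n}$ passing through $0$. Assume (G1) for $i=1,2$ the restrictions of $\omega$ and of $\tilde\omega$ to the tangent bundle $TS_i$ have the maximal possible rank $2[k/2]$ (at every point of $S_i$ near $0$); (G2) $T_0S_1\cap T_0S_2=\{0\}$; and $\omega(0)=\tilde\omega(0)$. Then the tuples $(\mathbb R^{2n},\omega,S_1\cup S_2)_0$ and $(\mathbb R^{2n},\tilde\omega,S_1\cup S_2)_0$ are diffeomorphic: there is a local diffeomorphism $\Phi:(\mathbb R^{2n},0)\to(\mathbb R^{2n},0)$ such that, as germs at $0$, $\Phi^*\tilde\omega=\omega$ and $\Phi(S_1\cup S_2)=S_1\cup S_2$. -/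

import Mathlib

open Filter Topology
open scoped ContDiff

namespace SymplecticTuple

variable {E E' : Type*} [NormedAddCommGroup E] [NormedSpace ℝ E]
  [NormedAddCommGroup E'] [NormedSpace ℝ E']

theorem update_fst {X : Type*} (a b c : X) : Function.update ![a, b] 0 c = ![c, b] := by
  ext i; fin_cases i <;> simp

theorem update_snd {X : Type*} (a b c : X) : Function.update ![a, b] 1 c = ![a, c] := by
  ext i; fin_cases i <;> simp

/-- The bilinear form `(u, v) ↦ η(u, v)` of an alternating 2-form `η`. -/
noncomputable def bilin (η : E [⋀^Fin 2]→L[ℝ] ℝ) : E →ₗ[ℝ] E →ₗ[ℝ] ℝ :=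
  LinearMap.mk₂ ℝ (fun u v => η ![u, v])
    (fun a b v => by
      simpa only [update_fst, smul_eq_mul] using η.map_update_add ![a, v] 0 a b)
    (fun c a v => by
      simpa only [update_fst, smul_eq_mul] using η.map_update_smul ![a, v] 0 c a)
    (fun u a b => by
      simpa only [update_snd, smul_eq_mul] using η.map_update_add ![u, a] 1 a b)
    (fun c u a => by
      simpa only [update_snd, smul_eq_mul] using η.map_update_smul ![u, a] 1 c a)

/-- The rank of the restriction `η|_U` of a 2-form `η` to a subspace `U`: the rank of the induced
linear map from `U` to its dual. -/
noncomputable def rankOn (η : E [⋀^Fin 2]→L[ℝ] ℝ) (U : Submodule ℝ E) : ℕ :=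
  Module.finrank ℝ (LinearMap.range ((bilin η).domRestrict₁₂ U U))

/-- `σ` represents the germ at `p` of a symplectic form of class `C^r`: near `p` it is of class
`C^r`, closed and nondegenerate. (One neighbourhood serves for all orders of differentiability.) -/
structure IsSymplecticGerm (r : WithTop ℕ∞) (σ : E → E [⋀^Fin 2]→L[ℝ] ℝ) (p : E) : Prop where
  contDiff : ∀ᶠ x in 𝓝 p, ContDiffAt ℝ r σ x
  closed : ∀ᶠ x in 𝓝 p, extDeriv σ x = 0
  nondegenerate : ∀ᶠ x in 𝓝 p, (bilin (σ x)).Nondegenerate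

/-- `Φ` is a local diffeomorphism of class `C^r`: a homeomorphism between open sets, of class `C^r`
together with its inverse. -/
structure IsLocalDiffeo (r : WithTop ℕ∞) (Φ : OpenPartialHomeomorph E E') : Prop where
  contDiffOn : ContDiffOn ℝ r Φ Φ.source
  contDiffOn_symm : ContDiffOn ℝ r Φ.symm Φ.target

/-- The set `S` represents the germ at `p ∈ S` of a `k`-dimensional (embedded) submanifold of class
`C^r`: a local diffeomorphism around `p` maps `S` onto a `k`-dimensional linear subspace. -/
def IsSubmanifoldGerm (r : WithTop ℕ∞) (k : ℕ) (S : Set E) (p : E) : Prop :=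
  p ∈ S ∧ ∃ (φ : OpenPartialHomeomorph E E) (F : Submodule ℝ E),
    IsLocalDiffeo r φ ∧ p ∈ φ.source ∧ Module.finrank ℝ F = k ∧
      φ '' (S ∩ φ.source) = (F : Set E) ∩ φ.target

/-- The tangent space `T_x S ⊆ E`, spanned by the velocities at `x` of curves in `S` through `x`.
(For a submanifold these velocities already form a linear subspace.) -/
def tangentSpaceOf (S : Set E) (x : E) : Submodule ℝ E :=
  Submodule.span ℝ {v | ∃ γ : ℝ → E, γ 0 = x ∧ (∀ᶠ t in 𝓝 0, γ t ∈ S) ∧ HasDerivAt γ v 0}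

/-- Maximality of the rank for one `k`-dimensional stratum `S`: the restriction of `σ` to the tangent bundle
of the germ of `S` at `p` has the maximal possible rank `2[k/2]`. -/
def HasMaximalRank (k : ℕ) (σ : E → E [⋀^Fin 2]→L[ℝ] ℝ) (S : Set E) (p : E) : Prop :=
  ∀ᶠ x in 𝓝[S] p, rankOn (σ x) (tangentSpaceOf S x) = 2 * (k / 2)

/-- The couple of `k`-dimensional strata `S₁`, `S₂` in a `2n`-dimensional space is
regular at `p`: `T_p S₁ ∩ T_p S₂ = 0` if `k ≤ n`, and `T_p S₁ + T_p S₂` is everything if `k > n`. -/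
def IsRegularCouple (n k : ℕ) (S₁ S₂ : Set E) (p : E) : Prop :=
  (k ≤ n → tangentSpaceOf S₁ p ⊓ tangentSpaceOf S₂ p = ⊥) ∧
  (n < k → tangentSpaceOf S₁ p ⊔ tangentSpaceOf S₂ p = ⊤)

/-- The tuples `(E, σ, N)_p` and `(E', σ', N')_{p'}` of germs are diffeomorphic in the class `C^r`:
there is a local diffeomorphism `Φ : (E, p) → (E', p')` with `Φ^* σ' = σ` near `p` and
`Φ(N) = N'` as germs (near `p`, a point lies in `N` iff its image lies in `N'`). -/
def AreDiffeomorphic (r : WithTop ℕ∞)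
    (σ : E → E [⋀^Fin 2]→L[ℝ] ℝ) (N : Set E) (p : E)
    (σ' : E' → E' [⋀^Fin 2]→L[ℝ] ℝ) (N' : Set E') (p' : E') : Prop :=
  ∃ Φ : OpenPartialHomeomorph E E',
    IsLocalDiffeo r Φ ∧ p ∈ Φ.source ∧ Φ p = p' ∧
    (∀ᶠ x in 𝓝 p, (σ' (Φ x)).compContinuousLinearMap (fderiv ℝ Φ x) = σ x) ∧
    (∀ᶠ x in 𝓝 p, x ∈ N ↔ Φ x ∈ N')

end SymplecticTuple

-- The proof is Moser's homotopy method, with the vector field kept tangent to both strata.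
--
-- A local diffeomorphism whose derivative at `0` is the identity turns the strata into linear
-- subspaces `L 0`, `L 1` with trivial intersection (`exists_simultaneous_straightening`); the
-- pulled back forms σ and τ still agree at `0`. Put δ = τ - σ and σ_t = σ + t δ. Since σ_t(0) =
-- σ(0), nondegeneracy and the maximal rank on each `L i` hold at `0` for every real t. The Poincaré
-- lemma (`exists_primitive_of_closed`) gives δ = dα, and δ(0) = 0 makes α vanish at `0` together
-- with its first derivatives. For any functions f_t, the field X_t with σ_t(X_t, ·) = -(α + df_t)
-- satisfies ∂_t σ_t + L_{X_t} σ_t = 0, so its flow transports σ_t. The freedom in f_t serves to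
-- make X_t tangent to the strata.
--
-- Tangency to L at points of L means α + df = -σ_t(Y, ·) with Y in L. If σ_t is nondegenerate on L,
-- the restriction of α to L determines Y, and it remains to prescribe df in the transversal
-- directions; a function linear in those directions does this. If k is odd, σ_t restricted to L has
-- a kernel line spanned by some K, and α + df must vanish on K, so the equation dg(K) = -α(K) is
-- solved first by characteristics (`exists_characteristic_correction`). Because α vanishes to
-- second order at `0`, the correction belonging to one stratum has zero differential along the
-- other (`exists_stratum_correction`), and the two corrections can simply be added
-- (`exists_moser_field`).
--
-- The smooth and the analytic category are treated together by making the composition y ↦ Z ∘ y a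
-- map of class `C^r` on spaces of continuous paths (`smoothNear_superpose`): local flows then come
-- from the inverse function theorem, and the integral in the Poincaré lemma becomes a linear map
-- applied to such a composition. Flows are needed only for short times: equivalence of σ_s and σ_t
-- is an equivalence relation on ℝ with open classes (`exists_short_time_formEquiv`), and ℝ is
-- connected.

universe u

namespace SymplecticTuple

/-! ### Superposition operators on spaces of continuous maps -/

section Superposition

variable {K V W : Type*} [TopologicalSpace K] [NormedAddCommGroup V] [NormedAddCommGroup W]

open Classical in
/-- The superposition operator `y ↦ Z ∘ y`, with the value `0` where `Z ∘ y` is not continuous. -/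
noncomputable def superpose (Z : V → W) (y : C(K, V)) : C(K, W) :=
  if h : Continuous (Z ∘ y) then ⟨Z ∘ y, h⟩ else 0

theorem superpose_apply {Z : V → W} {U : Set V} (hZ : ContinuousOn Z U) {y : C(K, V)}
    (hy : ∀ s, y s ∈ U) (s : K) : superpose Z y s = Z (y s) := by
  have : Continuous (Z ∘ y) := hZ.comp_continuous y.continuous hy
  simp [superpose, this]

variable [CompactSpace K]

theorem isOpen_setOf_forall_mem {U : Set V} (hU : IsOpen U) : IsOpen {y : C(K, V) | ∀ s, y s ∈ U} := by
  have := ContinuousMap.isOpen_setOfPred_mapsTo (X := K) (Y := V) isCompact_univ hU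
  simpa [Set.MapsTo] using this

variable [NormedSpace ℝ V] [NormedSpace ℝ W]

/-- Pointwise application of a continuous family of linear maps. -/
noncomputable def pointwiseApply : C(K, V →L[ℝ] W) →L[ℝ] C(K, V) →L[ℝ] C(K, W) :=
  LinearMap.mkContinuous₂
    (LinearMap.mk₂ ℝ (fun (A : C(K, V →L[ℝ] W)) (y : C(K, V)) =>
        (⟨fun s => A s (y s), by fun_prop⟩ : C(K, W)))
      (by intros; ext; simp) (by intros; ext; simp) (by intros; ext; simp) (by intros; ext; simp))
    1 (by
      intro A y
      rw [one_mul]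
      refine (ContinuousMap.norm_le _ (by positivity)).2 fun s => ?_
      exact (ContinuousLinearMap.le_opNorm _ _).trans
        (mul_le_mul (A.norm_coe_le_norm s) (y.norm_coe_le_norm s) (norm_nonneg _) (norm_nonneg A)))

@[simp]
theorem pointwiseApply_apply (A : C(K, V →L[ℝ] W)) (y : C(K, V)) (s : K) :
    pointwiseApply A y s = A s (y s) := rfl

/-- Strict differentiability of `Z` bounds the remainder locally uniformly, and compactness of `K`
turns this into a bound in the supremum norm. -/
theorem hasFDerivAt_superpose {Z : V → W} {U : Set V} (hU : IsOpen U) (hZ : ContDiffOn ℝ 1 Z U)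
    {y : C(K, V)} (hy : ∀ s, y s ∈ U) :
    HasFDerivAt (superpose (K := K) Z) (pointwiseApply (superpose (fderiv ℝ Z) y)) y := by
  have hfd : ContinuousOn (fderiv ℝ Z) U := hZ.continuousOn_fderiv_of_isOpen hU le_rfl
  rw [hasFDerivAt_iff_isLittleO_nhds_zero, Asymptotics.isLittleO_iff]
  intro ε hε
  -- One neighbourhood of `0` for the increment serves all points `s`; this is where compactness of
  -- `K` enters.
  have key : ∀ᶠ v : V in 𝓝 0, ∀ s ∈ (Set.univ : Set K),
      y s + v ∈ U ∧ ‖Z (y s + v) - Z (y s) - fderiv ℝ Z (y s) v‖ ≤ ε * ‖v‖ := by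
    refine isCompact_univ.eventually_forall_of_forall_eventually fun s _ => ?_
    have hyc : ContinuousAt (fun z : V × K => y z.2) (0, s) := by fun_prop
    have hyc' : ContinuousAt (fun z : V × K => y z.2 + z.1) (0, s) := by fun_prop
    have hmem : U ∈ 𝓝 (y s) := hU.mem_nhds (hy s)
    have h1 : ∀ᶠ z : V × K in 𝓝 (0, s), y z.2 + z.1 ∈ U :=
      hyc'.eventually (by simpa using hmem)
    have hst := (hZ.contDiffAt hmem).hasStrictFDerivAt one_ne_zero
    have h2 := (Asymptotics.isLittleO_iff.1 hst.isLittleO) (half_pos hε)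
    have hpair : Tendsto (fun z : V × K => (y z.2 + z.1, y z.2)) (𝓝 (0, s)) (𝓝 (y s, y s)) := by
      have : ContinuousAt (fun z : V × K => (y z.2 + z.1, y z.2)) (0, s) := by fun_prop
      simpa [ContinuousAt] using this
    have h2' := hpair.eventually h2
    have h3 : ∀ᶠ z : V × K in 𝓝 (0, s), ‖fderiv ℝ Z (y z.2) - fderiv ℝ Z (y s)‖ < ε / 2 := by
      have hc : ContinuousAt (fun z : V × K => fderiv ℝ Z (y z.2)) (0, s) :=
        ContinuousAt.comp (f := fun z : V × K => y z.2) (hfd.continuousAt hmem) hyc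
      have := (hc.sub (continuousAt_const (y := fderiv ℝ Z (y s)))).norm
      exact this.eventually (gt_mem_nhds (by simpa using half_pos hε))
    filter_upwards [h1, h2', h3] with z hz1 hz2 hz3
    refine ⟨hz1, ?_⟩
    simp only [add_sub_cancel_left] at hz2
    calc ‖Z (y z.2 + z.1) - Z (y z.2) - fderiv ℝ Z (y z.2) z.1‖
        = ‖(Z (y z.2 + z.1) - Z (y z.2) - fderiv ℝ Z (y s) z.1)
            - (fderiv ℝ Z (y z.2) - fderiv ℝ Z (y s)) z.1‖ := by
          congr 1; simp
      _ ≤ ε / 2 * ‖z.1‖ + ε / 2 * ‖z.1‖ := by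
          refine (norm_sub_le _ _).trans (add_le_add hz2 ?_)
          exact (ContinuousLinearMap.le_opNorm _ _).trans
            (mul_le_mul_of_nonneg_right hz3.le (norm_nonneg _))
      _ = ε * ‖z.1‖ := by ring
  obtain ⟨δ, hδ, hball⟩ := Metric.eventually_nhds_iff.1 key
  filter_upwards [Metric.ball_mem_nhds (0 : C(K, V)) hδ] with h hh
  have hhs : ∀ s, dist (h s) 0 < δ := fun s => by
    rw [dist_zero_right]
    exact (h.norm_coe_le_norm s).trans_lt (by simpa using hh)
  refine (ContinuousMap.norm_le _ (by positivity)).2 fun s => ?_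
  have hs := fun s => hball (hhs s) s (Set.mem_univ s)
  have e1 : superpose Z (y + h) s = Z (y s + h s) :=
    superpose_apply hZ.continuousOn (y := y + h) (fun s => by simpa using (hs s).1) s
  have e2 : superpose Z y s = Z (y s) := superpose_apply hZ.continuousOn hy s
  have e3 : superpose (fderiv ℝ Z) y s = fderiv ℝ Z (y s) := superpose_apply hfd hy s
  simp only [ContinuousMap.sub_apply, pointwiseApply_apply, e1, e2, e3]
  exact (hs s).2.trans (mul_le_mul_of_nonneg_left (h.norm_coe_le_norm s) hε.le)

/-- The derivative is a linear map applied to the superposition operator of `fderiv ℝ Z`, which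
allows induction on `n`. The lost order of differentiability is harmless for `C^∞`. The induction
replaces `W` by `V →L[ℝ] W`, hence the common universe. -/
theorem contDiffOn_superpose_nat (n : ℕ) {V W : Type u} [NormedAddCommGroup V] [NormedSpace ℝ V]
    [NormedAddCommGroup W] [NormedSpace ℝ W] {Z : V → W} {U : Set V} (hU : IsOpen U)
    (hZ : ContDiffOn ℝ (n + 1) Z U) :
    ContDiffOn ℝ n (superpose (K := K) Z) {y | ∀ s, y s ∈ U} := by
  induction n generalizing W with
  | zero =>
    refine contDiffOn_zero.2 fun y hy => ?_
    exact (hasFDerivAt_superpose hU (by simpa using hZ) hy).continuousAt.continuousWithinAt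
  | succ n ih =>
    have h1 : ContDiffOn ℝ 1 Z U := hZ.of_le (by simp)
    have hd := fun y hy => hasFDerivAt_superpose (K := K) hU h1 (y := y) hy
    push_cast
    rw [contDiffOn_succ_iff_fderiv_of_isOpen (isOpen_setOf_forall_mem hU)]
    refine ⟨fun y hy => (hd y hy).differentiableAt.differentiableWithinAt, by simp, ?_⟩
    have hfd : ContDiffOn ℝ (n + 1) (fderiv ℝ Z) U :=
      hZ.fderiv_of_isOpen hU (by simp)
    have hL : ContDiff ℝ n (pointwiseApply (K := K) (V := V) (W := W)) :=
      ContinuousLinearMap.contDiff _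
    exact (hL.comp_contDiffOn (ih hfd)).congr fun y hy => (hd y hy).fderiv

/-- The pointwise action of a multilinear map on continuous maps. -/
noncomputable def pointwiseMultilinear {n : ℕ} (p : V [×n]→L[ℝ] W) :
    C(K, V) [×n]→L[ℝ] C(K, W) :=
  MultilinearMap.mkContinuous
    { toFun := fun m => ⟨fun s => p fun i => m i s, by fun_prop⟩
      map_update_add' := by
        intro _ m i x y
        ext s
        have h : ∀ z : C(K, V), (fun j => Function.update m i z j s) =
            Function.update (fun j => m j s) i (z s) := by
          intro z; ext j; by_cases hj : j = i
          · subst hj; simp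
          · simp [hj]
        simp [h]
      map_update_smul' := by
        intro _ m i c x
        ext s
        have h : ∀ z : C(K, V), (fun j => Function.update m i z j s) =
            Function.update (fun j => m j s) i (z s) := by
          intro z; ext j; by_cases hj : j = i
          · subst hj; simp
          · simp [hj]
        simp [h] }
    ‖p‖ (by
      intro m
      refine (ContinuousMap.norm_le _ (by positivity)).2 fun s => ?_
      refine (p.le_opNorm _).trans (mul_le_mul_of_nonneg_left ?_ (norm_nonneg _))
      exact Finset.prod_le_prod (fun _ _ => norm_nonneg _) fun i _ => (m i).norm_coe_le_norm s)

theorem norm_pointwiseMultilinear_le {n : ℕ} (p : V [×n]→L[ℝ] W) :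
    ‖pointwiseMultilinear (K := K) p‖ ≤ ‖p‖ :=
  MultilinearMap.mkContinuous_norm_le _ (norm_nonneg _) _

/-- The Taylor series of `Z` at `p₀`, applied pointwise, is a power series on `C(K, V)` with at
least the same radius, since passing to pointwise action does not increase norms. The centre is a
constant map so that one series serves all points of `K`. -/
theorem analyticAt_superpose [CompleteSpace W] {Z : V → W} {p₀ : V} (hZ : AnalyticAt ℝ Z p₀) :
    AnalyticAt ℝ (superpose (K := K) Z) (ContinuousMap.const K p₀) := by
  obtain ⟨p, r, hp⟩ := hZ
  refine ⟨fun n => pointwiseMultilinear (p n), r,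
    hp.r_le.trans (FormalMultilinearSeries.radius_le_of_le fun n => norm_pointwiseMultilinear_le _),
    hp.r_pos, fun {y} hy => ?_⟩
  have hy' : (‖y‖₊ : ENNReal) < r := by simpa [enorm] using hy
  have hsum : Summable fun n => pointwiseMultilinear (K := K) (p n) fun _ => y := by
    refine Summable.of_norm_bounded (p.summable_norm_mul_pow (hy'.trans_le hp.r_le)) fun n => ?_
    refine (ContinuousMultilinearMap.le_opNorm _ _).trans ?_
    simp only [Finset.prod_const, Finset.card_univ, Fintype.card_fin, coe_nnnorm]
    exact mul_le_mul_of_nonneg_right (norm_pointwiseMultilinear_le _) (by positivity)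
  obtain ⟨S, hS⟩ := hsum
  have hSs : ∀ s, S s = Z (p₀ + y s) := by
    intro s
    have h1 := (ContinuousMap.evalCLM ℝ (M := W) s).hasSum hS
    have hys : y s ∈ Metric.eball (0 : V) r := by
      have : (‖y s‖₊ : ENNReal) < r :=
        lt_of_le_of_lt (by exact_mod_cast y.norm_coe_le_norm s) hy'
      simpa [enorm] using this
    exact h1.unique (hp.hasSum hys)
  -- The sum `S` lives in `C(K, W)`, so `Z ∘ (p₀ + y)` is continuous and the default value of
  -- `superpose` does not occur.
  have : superpose Z (ContinuousMap.const K p₀ + y) = S := by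
    have hc : Z ∘ (ContinuousMap.const K p₀ + y) = S := by ext s; simp [hSs]
    have : Continuous (Z ∘ (ContinuousMap.const K p₀ + y)) := hc ▸ S.continuous
    ext s
    simp only [superpose, this, ↓reduceDIte]
    simp [hSs]
  rwa [this]

end Superposition

/-! ### Germs of maps of class `C^r` -/

/-- `f` is of class `C^r` near `a`. -/
def SmoothNear {V W : Type*} [NormedAddCommGroup V] [NormedSpace ℝ V]
    [NormedAddCommGroup W] [NormedSpace ℝ W] (r : WithTop ℕ∞) (f : V → W) (a : V) : Prop :=
  ∀ᶠ x in 𝓝 a, ContDiffAt ℝ r f x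

/-- This is the common source of regularity in both categories. A constant centre is enough in the
analytic case because analyticity is an open condition. -/
theorem smoothNear_superpose {K : Type*} {V W : Type u} [TopologicalSpace K] [CompactSpace K]
    [NormedAddCommGroup V] [NormedSpace ℝ V] [NormedAddCommGroup W] [NormedSpace ℝ W]
    [CompleteSpace W] {r : WithTop ℕ∞} (hr : r = ∞ ∨ r = ω) {Z : V → W} {p₀ : V}
    (hZ : SmoothNear r Z p₀) : SmoothNear r (superpose (K := K) Z) (ContinuousMap.const K p₀) := by
  obtain rfl | rfl := hr
  · obtain ⟨U, hUs, hU, hpU⟩ := eventually_nhds_iff.1 hZ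
    have hopen := isOpen_setOf_forall_mem (K := K) hU
    filter_upwards [hopen.mem_nhds (by simpa using fun _ => hpU)] with y hy
    refine contDiffAt_infty.2 fun n => ?_
    refine (contDiffOn_superpose_nat n hU fun x hx => ?_).contDiffAt (hopen.mem_nhds hy)
    exact ((hUs x hx).of_le (by exact_mod_cast le_top)).contDiffWithinAt
  · have := (analyticAt_superpose (K := K) hZ.self_of_nhds.analyticAt).eventually_analyticAt
    exact this.mono fun y hy => hy.contDiffAt

section SmoothNear

variable {V W X : Type*} [NormedAddCommGroup V] [NormedSpace ℝ V]
  [NormedAddCommGroup W] [NormedSpace ℝ W] [NormedAddCommGroup X] [NormedSpace ℝ X]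
  {r : WithTop ℕ∞}

theorem add_one_le_of_infty_or_omega (hr : r = ∞ ∨ r = ω) : r + 1 ≤ r := by
  rcases hr with rfl | rfl <;> simp

theorem natCast_le_of_infty_or_omega (hr : r = ∞ ∨ r = ω) (n : ℕ) : (n : WithTop ℕ∞) ≤ r := by
  rcases hr with rfl | rfl
  · exact_mod_cast le_top
  · exact le_top

theorem one_le_of_infty_or_omega (hr : r = ∞ ∨ r = ω) : 1 ≤ r := by
  simpa using natCast_le_of_infty_or_omega hr 1

theorem minSmoothness_le_of_infty_or_omega (hr : r = ∞ ∨ r = ω) : minSmoothness ℝ 2 ≤ r := by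
  simpa using natCast_le_of_infty_or_omega hr 2

theorem ne_zero_of_infty_or_omega (hr : r = ∞ ∨ r = ω) : r ≠ 0 := by
  rcases hr with rfl | rfl <;> simp

theorem SmoothNear.contDiffAt {f : V → W} {a : V} (hf : SmoothNear r f a) : ContDiffAt ℝ r f a :=
  hf.self_of_nhds

theorem SmoothNear.continuousAt {f : V → W} {a : V} (hf : SmoothNear r f a) : ContinuousAt f a :=
  hf.contDiffAt.continuousAt

theorem _root_.ContDiff.smoothNear {f : V → W} (hf : ContDiff ℝ r f) (a : V) : SmoothNear r f a :=
  Eventually.of_forall fun _ => hf.contDiffAt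

theorem SmoothNear.comp {g : W → X} {f : V → W} {a : V} (hg : SmoothNear r g (f a))
    (hf : SmoothNear r f a) : SmoothNear r (fun x => g (f x)) a := by
  filter_upwards [hf, hf.continuousAt.eventually hg] with x h1 h2
  exact h2.comp x h1

theorem SmoothNear.comp_of_eq {g : W → X} {f : V → W} {a : V} {b : W} (hg : SmoothNear r g b)
    (hf : SmoothNear r f a) (hb : f a = b) : SmoothNear r (fun x => g (f x)) a := by
  subst hb; exact hg.comp hf

theorem SmoothNear.add {f g : V → W} {a : V} (hf : SmoothNear r f a) (hg : SmoothNear r g a) :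
    SmoothNear r (fun x => f x + g x) a := by
  filter_upwards [hf, hg] with x h1 h2 using h1.add h2

theorem SmoothNear.sub {f g : V → W} {a : V} (hf : SmoothNear r f a) (hg : SmoothNear r g a) :
    SmoothNear r (fun x => f x - g x) a := by
  filter_upwards [hf, hg] with x h1 h2 using h1.sub h2

theorem SmoothNear.neg {f : V → W} {a : V} (hf : SmoothNear r f a) :
    SmoothNear r (fun x => -f x) a := by
  filter_upwards [hf] with x h1 using h1.neg

theorem SmoothNear.smul {f : V → ℝ} {g : V → W} {a : V} (hf : SmoothNear r f a)
    (hg : SmoothNear r g a) : SmoothNear r (fun x => f x • g x) a := by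
  filter_upwards [hf, hg] with x h1 h2 using h1.smul h2

theorem SmoothNear.prodMk {f : V → W} {g : V → X} {a : V} (hf : SmoothNear r f a)
    (hg : SmoothNear r g a) : SmoothNear r (fun x => (f x, g x)) a := by
  filter_upwards [hf, hg] with x h1 h2 using h1.prodMk h2

theorem SmoothNear.clm_apply {f : V → W →L[ℝ] X} {g : V → W} {a : V} (hf : SmoothNear r f a)
    (hg : SmoothNear r g a) : SmoothNear r (fun x => f x (g x)) a := by
  filter_upwards [hf, hg] with x h1 h2 using h1.clm_apply h2

theorem SmoothNear.clm_comp {Y : Type*} [NormedAddCommGroup Y] [NormedSpace ℝ Y]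
    {f : V → W →L[ℝ] X} {g : V → Y →L[ℝ] W} {a : V} (hf : SmoothNear r f a)
    (hg : SmoothNear r g a) : SmoothNear r (fun x => (f x).comp (g x)) a := by
  filter_upwards [hf, hg] with x h1 h2 using h1.clm_comp h2

theorem smoothNear_const (c : W) (a : V) : SmoothNear r (fun _ : V => c) a :=
  contDiff_const.smoothNear a

theorem smoothNear_id (a : V) : SmoothNear r (fun x : V => x) a :=
  contDiff_id.smoothNear a

theorem SmoothNear.clm (L : W →L[ℝ] X) {f : V → W} {a : V} (hf : SmoothNear r f a) :
    SmoothNear r (fun x => L (f x)) a :=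
  (L.contDiff.smoothNear _).comp hf

theorem SmoothNear.fderiv (hr : r = ∞ ∨ r = ω) {f : V → W} {a : V} (hf : SmoothNear r f a) :
    SmoothNear r (fderiv ℝ f) a := by
  filter_upwards [hf] with x h using h.fderiv_right (add_one_le_of_infty_or_omega hr)

theorem SmoothNear.eventually_differentiableAt (hr : r = ∞ ∨ r = ω) {f : V → W} {a : V}
    (hf : SmoothNear r f a) : ∀ᶠ x in 𝓝 a, DifferentiableAt ℝ f x :=
  hf.mono fun _ h => h.differentiableAt (ne_zero_of_infty_or_omega hr)

theorem SmoothNear.differentiableAt (hr : r = ∞ ∨ r = ω) {f : V → W} {a : V}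
    (hf : SmoothNear r f a) : DifferentiableAt ℝ f a :=
  (hf.eventually_differentiableAt hr).self_of_nhds

theorem SmoothNear.inverse [CompleteSpace W] {f : V → W →L[ℝ] X} {a : V} (hf : SmoothNear r f a)
    (e : W ≃L[ℝ] X) (he : f a = e) :
    SmoothNear r (fun x => (f x).inverse) a ∧ ∀ᶠ x in 𝓝 a, ∃ e' : W ≃L[ℝ] X, f x = e' := by
  have h : ∀ᶠ x in 𝓝 a, ∃ e' : W ≃L[ℝ] X, f x = e' := by
    have : Set.range ((↑) : (W ≃L[ℝ] X) → W →L[ℝ] X) ∈ 𝓝 (f a) := by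
      rw [he]; exact e.nhds
    filter_upwards [hf.continuousAt.eventually this] with x ⟨e', he'⟩
    exact ⟨e', he'.symm⟩
  refine ⟨?_, h⟩
  filter_upwards [hf, h] with x h1 ⟨e', he'⟩
  have := contDiffAt_map_inverse (𝕜 := ℝ) (n := r) e'
  rw [← he'] at this
  exact this.comp x h1

/-- The inverse function theorem as a statement on local diffeomorphisms. -/
theorem SmoothNear.exists_isLocalDiffeo [CompleteSpace V] (hr : r = ∞ ∨ r = ω) {f : V → W} {a : V}
    (hf : SmoothNear r f a) {f' : V ≃L[ℝ] W} (hf' : HasFDerivAt f (f' : V →L[ℝ] W) a) :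
    ∃ Ψ : OpenPartialHomeomorph V W, IsLocalDiffeo r Ψ ∧ a ∈ Ψ.source ∧ ⇑Ψ = f := by
  have hr0 := ne_zero_of_infty_or_omega hr
  let Ψ := hf.contDiffAt.toOpenPartialHomeomorph f hf' hr0
  have hΨ : ⇑Ψ = f := rfl
  -- The derivative has to be invertible on the whole source, since the inverse must be of class
  -- `C^r` on the whole target.
  have hinv := ((hf.fderiv hr).inverse f' hf'.fderiv).2
  obtain ⟨s, hs, hso, has⟩ := eventually_nhds_iff.1 (hf.and hinv)
  refine ⟨Ψ.restrOpen s hso, ⟨?_, ?_⟩, ?_, ?_⟩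
  · intro x hx
    rw [OpenPartialHomeomorph.restrOpen_source] at hx
    exact (hs x hx.2).1.contDiffWithinAt
  · intro y hy
    have hx := (Ψ.restrOpen s hso).map_target hy
    rw [OpenPartialHomeomorph.restrOpen_source] at hx
    obtain ⟨h1, e, he⟩ := hs _ hx.2
    refine ((Ψ.restrOpen s hso).contDiffAt_symm hy (f₀' := e) ?_ h1).contDiffWithinAt
    rw [← he]
    exact (h1.differentiableAt hr0).hasFDerivAt
  · rw [OpenPartialHomeomorph.restrOpen_source]
    exact ⟨hf.contDiffAt.mem_toOpenPartialHomeomorph_source hf' hr0, has⟩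
  · rfl

theorem IsLocalDiffeo.smoothNear {Ψ : OpenPartialHomeomorph V W} (h : IsLocalDiffeo r Ψ) {a : V}
    (ha : a ∈ Ψ.source) : SmoothNear r Ψ a := by
  filter_upwards [Ψ.open_source.mem_nhds ha] with x hx
  exact h.contDiffOn.contDiffAt (Ψ.open_source.mem_nhds hx)

theorem IsLocalDiffeo.symm {Ψ : OpenPartialHomeomorph V W} (h : IsLocalDiffeo r Ψ) :
    IsLocalDiffeo r Ψ.symm :=
  ⟨h.contDiffOn_symm, by simpa using h.contDiffOn⟩

theorem IsLocalDiffeo.trans {Y : Type*} [NormedAddCommGroup Y] [NormedSpace ℝ Y]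
    {Ψ : OpenPartialHomeomorph V W} {Θ : OpenPartialHomeomorph W Y} (h : IsLocalDiffeo r Ψ)
    (h' : IsLocalDiffeo r Θ) : IsLocalDiffeo r (Ψ.trans Θ) := by
  constructor
  · rw [OpenPartialHomeomorph.coe_trans, OpenPartialHomeomorph.trans_source]
    exact h'.contDiffOn.comp (h.contDiffOn.mono Set.inter_subset_left) fun x hx => hx.2
  · rw [OpenPartialHomeomorph.coe_trans_symm, OpenPartialHomeomorph.trans_target]
    exact h.contDiffOn_symm.comp (h'.contDiffOn_symm.mono Set.inter_subset_left) fun x hx => hx.2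

end SmoothNear

/-! ### Local flows -/

section Flow

/-- The interval `[-1, 1]` on which rescaled trajectories are parametrized. -/
abbrev TimeInterval : Type := Set.Icc (-1 : ℝ) 1

/-- The projection of the real line to `[-1, 1]`. -/
noncomputable def timeProj : ℝ → TimeInterval := Set.projIcc (-1) 1 (by norm_num)

theorem continuous_timeProj : Continuous timeProj := continuous_projIcc

theorem timeProj_of_mem {s : ℝ} (hs : s ∈ Set.Icc (-1 : ℝ) 1) : timeProj s = ⟨s, hs⟩ :=
  Set.projIcc_of_mem _ hs

theorem timeProj_coe (s : TimeInterval) : timeProj s = s := timeProj_of_mem s.2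

variable {V : Type*} [NormedAddCommGroup V] [NormedSpace ℝ V]

/-- The primitive vanishing at `0` of a path parametrized by `[-1, 1]`. -/
noncomputable def primitive : C(TimeInterval, V) →L[ℝ] C(TimeInterval, V) :=
  LinearMap.mkContinuous
    { toFun := fun y => ⟨fun s => ∫ u in (0 : ℝ)..s, y (timeProj u), by
        have hy : Continuous fun u => y (timeProj u) := y.continuous.comp continuous_timeProj
        exact (intervalIntegral.continuous_primitive (fun a b => hy.intervalIntegrable a b) 0).comp
          continuous_subtype_val⟩
      map_add' := fun x y => by
        ext s
        have hx : Continuous fun u => x (timeProj u) := x.continuous.comp continuous_timeProj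
        have hy : Continuous fun u => y (timeProj u) := y.continuous.comp continuous_timeProj
        exact intervalIntegral.integral_add (hx.intervalIntegrable _ _) (hy.intervalIntegrable _ _)
      map_smul' := fun c y => by
        ext s
        exact intervalIntegral.integral_smul c _ }
    1 (fun y => by
      refine (ContinuousMap.norm_le _ (by positivity)).2 fun s => ?_
      refine (intervalIntegral.norm_integral_le_of_norm_le_const
        fun x _ => y.norm_coe_le_norm _).trans ?_
      rw [one_mul, sub_zero]
      exact mul_le_of_le_one_right (norm_nonneg y) (abs_le.2 s.2))

/-- Constant paths, as a continuous linear map. -/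
noncomputable def constPath : V →L[ℝ] C(TimeInterval, V) :=
  LinearMap.mkContinuous
    { toFun := fun p => ContinuousMap.const _ p
      map_add' := fun _ _ => rfl
      map_smul' := fun _ _ => rfl } 1 fun p => by
    rw [one_mul]; exact (ContinuousMap.norm_le _ (by positivity)).2 fun s => le_rfl

end Flow

section LocalFlow

variable {V : Type u} [NormedAddCommGroup V] [NormedSpace ℝ V]

/-- The path `u ↦ y (s u)`. -/
noncomputable def rescalePath (y : C(TimeInterval, V)) (s : TimeInterval) : C(TimeInterval, V) :=
  ⟨fun u => y (timeProj (s * u)), y.continuous.comp (continuous_timeProj.comp (by fun_prop))⟩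

theorem mul_mem_timeInterval (s u : TimeInterval) : (s * u : ℝ) ∈ Set.Icc (-1 : ℝ) 1 := by
  rw [Set.mem_Icc, ← abs_le, abs_mul]
  exact mul_le_one₀ (abs_le.2 s.2) (abs_nonneg _) (abs_le.2 u.2)

/-- The equation of trajectories: `y` is a trajectory on `[-1, 1]` of `λ Z` starting at `p`. -/
theorem rescalePath_of_isTrajectory {Z : V → V} {U : Set V} (hZ : ContinuousOn Z U) {l : ℝ} {p : V}
    {y : C(TimeInterval, V)} (hyU : ∀ s, y s ∈ U)
    (hy : y = constPath p + l • primitive (superpose Z y)) (s : TimeInterval) :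
    rescalePath y s =
      constPath p + (l * s) • primitive (superpose Z (rescalePath y s)) := by
  have hU' : ∀ v, rescalePath y s v ∈ U := fun v => hyU _
  ext v
  have h1 : rescalePath y s v = y ⟨s * v, mul_mem_timeInterval s v⟩ := by
    change y (timeProj (s * v)) = _
    rw [timeProj_of_mem (mul_mem_timeInterval s v)]
  rw [h1]
  conv_lhs => rw [hy]
  change p + l • ∫ u in (0 : ℝ)..(s * v : ℝ), superpose Z y (timeProj u) =
    p + (l * s) • ∫ u in (0 : ℝ)..v, superpose Z (rescalePath y s) (timeProj u)
  rw [mul_smul]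
  congr 2
  -- The substitution `u ↦ s u` in the integral equation turns the factor `l` into `l * s`.
  have h2 := intervalIntegral.smul_integral_comp_mul_left (a := 0) (b := (v : ℝ))
    (fun u => superpose Z y (timeProj u)) (s : ℝ)
  rw [mul_zero] at h2
  rw [← h2]
  congr 1
  refine intervalIntegral.integral_congr fun u hu => ?_
  have hu' : u ∈ Set.Icc (-1 : ℝ) 1 := by
    rcases Set.mem_uIcc.1 hu with h | h
    · exact ⟨by linarith [h.1], h.2.trans v.2.2⟩
    · exact ⟨v.2.1.trans h.1, by linarith [h.2]⟩
  rw [superpose_apply hZ hyU, superpose_apply hZ hU']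
  change Z (y (timeProj (s * u))) = Z (y (timeProj (s * (timeProj u : ℝ))))
  rw [timeProj_of_mem hu']

/-- The equation `y = c p + l • G y` has a unique solution `y` near `c p₀`, which depends on `(l, p)`
near `(0, p₀)` in the class `C^r`. -/
theorem exists_solution_family [CompleteSpace V] {X : Type*} [NormedAddCommGroup X]
    [NormedSpace ℝ X] [CompleteSpace X] {r : WithTop ℕ∞} (hr : r = ∞ ∨ r = ω) (c : V →L[ℝ] X)
    {G : X → X} {p₀ : V} (hG : SmoothNear r G (c p₀)) :
    ∃ Y : ℝ × V → X, SmoothNear r Y (0, p₀) ∧ Y (0, p₀) = c p₀ ∧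
      (∀ᶠ q in 𝓝 ((0 : ℝ), p₀), Y q = c q.2 + q.1 • G (Y q)) ∧
      ∃ ε > 0, ∀ q y, dist q ((0 : ℝ), p₀) < ε → dist y (c p₀) < ε →
        y = c q.2 + q.1 • G y → y = Y q := by
  let F : (ℝ × V) × X → (ℝ × V) × X := fun x =>
    (x.1, x.2 - c x.1.2 - x.1.1 • G x.2)
  let a₀ : (ℝ × V) × X := ((0, p₀), c p₀)
  have hF1 : SmoothNear r (fun x : (ℝ × V) × X => x.1) a₀ :=
    contDiff_fst.smoothNear _
  have hF2 : SmoothNear r (fun x : (ℝ × V) × X => x.2) a₀ :=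
    contDiff_snd.smoothNear _
  have hF11 : SmoothNear r (fun x : (ℝ × V) × X => x.1.1) a₀ :=
    (contDiff_fst.comp contDiff_fst).smoothNear _
  have hF12 : SmoothNear r (fun x : (ℝ × V) × X => x.1.2) a₀ :=
    (contDiff_snd.comp contDiff_fst).smoothNear _
  have hGx : SmoothNear r (fun x : (ℝ × V) × X =>
      G x.2) a₀ := hG.comp_of_eq hF2 rfl
  have hF : SmoothNear r F a₀ := hF1.prodMk ((hF2.sub (hF12.clm c)).sub (hF11.smul hGx))
  let M : (ℝ × V) →L[ℝ] X :=
    -(c.comp (ContinuousLinearMap.snd ℝ ℝ V)) -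
      (ContinuousLinearMap.fst ℝ ℝ V).smulRight (G (c p₀))
  -- At `l = 0` the factor `l` kills the derivative of `G`, so the derivative of `F` is triangular
  -- with identities on the diagonal, whatever `G` is.
  let e : ((ℝ × V) × X) ≃L[ℝ] ((ℝ × V) × X) :=
    (ContinuousLinearEquiv.refl ℝ (ℝ × V)).skewProd (ContinuousLinearEquiv.refl ℝ _) M
  have hF' : HasFDerivAt F (e : _ →L[ℝ] _) a₀ := by
    have hGd := (hGx.differentiableAt hr).hasFDerivAt
    have d1 : HasFDerivAt (fun x : (ℝ × V) × X => x.1.1)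
        ((ContinuousLinearMap.fst ℝ ℝ V).comp (ContinuousLinearMap.fst ℝ _ _)) a₀ :=
      ((ContinuousLinearMap.fst ℝ ℝ V).comp (ContinuousLinearMap.fst ℝ (ℝ × V) X)).hasFDerivAt
    have d2 := d1.smul hGd
    have d3 : HasFDerivAt (fun x : (ℝ × V) × X => c x.1.2)
        (c.comp ((ContinuousLinearMap.snd ℝ ℝ V).comp (ContinuousLinearMap.fst ℝ _ _))) a₀ :=
      (c.comp ((ContinuousLinearMap.snd ℝ ℝ V).comp
        (ContinuousLinearMap.fst ℝ (ℝ × V) X))).hasFDerivAt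
    have d4 : HasFDerivAt (fun x : (ℝ × V) × X => x.2)
        (ContinuousLinearMap.snd ℝ _ _) a₀ := hasFDerivAt_snd
    have d5 : HasFDerivAt (fun x : (ℝ × V) × X => x.1)
        (ContinuousLinearMap.fst ℝ _ _) a₀ := hasFDerivAt_fst
    refine (d5.prodMk ((d4.sub d3).sub d2)).congr_fderiv ?_
    refine ContinuousLinearMap.ext fun x => Prod.ext rfl ?_
    change x.2 - c x.1.2 - ((0 : ℝ) • _ + x.1.1 • G (c p₀)) =
      x.2 + (-c x.1.2 - x.1.1 • G (c p₀))
    rw [zero_smul, zero_add]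
    abel
  obtain ⟨Ψ, hΨd, haΨ, hΨF⟩ := hF.exists_isLocalDiffeo hr hF'
  have hFa : F a₀ = ((0, p₀), 0) := by simp [F, a₀]
  have htgt : ((0, p₀), 0) ∈ Ψ.target := by rw [← hFa, ← hΨF]; exact Ψ.map_source haΨ
  have hsymm₀ : Ψ.symm ((0, p₀), 0) = a₀ := by rw [← hFa, ← hΨF]; exact Ψ.left_inv haΨ
  obtain ⟨ε, hε, hεs⟩ := Metric.mem_nhds_iff.1 (Ψ.open_source.mem_nhds haΨ)
  refine ⟨fun q => (Ψ.symm (q, 0)).2, ?_, ?_, ?_, ε, hε, ?_⟩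
  · have h1 : SmoothNear r (fun q : ℝ × V => (q, (0 : X))) (0, p₀) :=
      (contDiff_id.prodMk contDiff_const).smoothNear _
    have h2 := (hΨd.symm.smoothNear (a := ((0, p₀), 0)) htgt).comp_of_eq h1 rfl
    exact h2.clm (ContinuousLinearMap.snd ℝ _ _)
  · simp only [hsymm₀, a₀]
  · have hc : ContinuousAt (fun q : ℝ × V => (q, (0 : X))) (0, p₀) := by fun_prop
    filter_upwards [hc.eventually (Ψ.open_target.mem_nhds htgt)] with q hq
    have h1 := Ψ.right_inv hq
    rw [hΨF] at h1
    have h2 : (Ψ.symm (q, 0)).1 = q := congrArg Prod.fst h1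
    have h3 := congrArg Prod.snd h1
    simp only [F, h2] at h3
    rwa [sub_sub, sub_eq_zero] at h3
  · intro q y hq hy h
    have hsrc : (q, y) ∈ Ψ.source := by
      apply hεs
      rw [Metric.mem_ball, Prod.dist_eq, max_lt_iff]
      exact ⟨hq, hy⟩
    have h5 : Ψ (q, y) = (q, 0) := by
      rw [hΨF]
      refine Prod.ext rfl ?_
      change y - c q.2 - q.1 • G y = 0
      rwa [sub_sub, sub_eq_zero]
    have h6 := Ψ.left_inv hsrc
    rw [h5] at h6
    exact (congrArg Prod.snd h6).symm

/-- A vector field of class `C^r` has a local flow of class `C^r`. -/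
theorem exists_local_flow [CompleteSpace V] {r : WithTop ℕ∞} (hr : r = ∞ ∨ r = ω) {Z : V → V}
    {p₀ : V} (hZ : SmoothNear r Z p₀) :
    ∃ φ : ℝ × V → V, SmoothNear r φ (0, p₀) ∧
      (∀ᶠ q in 𝓝 ((0 : ℝ), p₀), HasDerivAt (fun s => φ (s, q.2)) (Z (φ q)) q.1) ∧
      ∀ᶠ p in 𝓝 p₀, φ (0, p) = p := by
  obtain ⟨Y, hYs, hY₀, hY, ε, hε, huniq⟩ := exists_solution_family hr constPath
    (G := fun y => primitive (superpose Z y)) ((smoothNear_superpose hr hZ).clm primitive)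
  obtain ⟨U, hUs, hUo, hpU⟩ := eventually_nhds_iff.1 hZ
  have hZU : ContinuousOn Z U := fun x hx => (hUs x hx).continuousAt.continuousWithinAt
  obtain ⟨η, hη, hηU⟩ := Metric.mem_nhds_iff.1 (hUo.mem_nhds hpU)
  have hclose : ∀ᶠ q in 𝓝 ((0 : ℝ), p₀), dist (Y q) (constPath p₀) < min ε η := by
    have := hYs.continuousAt.eventually (Metric.ball_mem_nhds (Y (0, p₀)) (lt_min hε hη))
    rwa [hY₀] at this
  obtain ⟨δ, hδ, hδs⟩ := Metric.eventually_nhds_iff.1 ((hY.and hclose).and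
    (Metric.ball_mem_nhds ((0 : ℝ), p₀) hε))
  -- `Y (l, p)` is the trajectory of `l • Z` on the fixed interval `[-1, 1]`; its value at `1` is
  -- the position at time `l` under `Z`.
  let φ : ℝ × V → V := fun q => Y q ⟨1, by norm_num⟩
  have hdist : ∀ (m : ℝ) (p : V), dist (m, p) ((0 : ℝ), p₀) < δ ↔ |m| < δ ∧ dist p p₀ < δ := by
    intro m p
    rw [Prod.dist_eq, max_lt_iff, Real.dist_eq, sub_zero]
  have hYU : ∀ (l : ℝ) (p : V), |l| < δ → dist p p₀ < δ → ∀ v, Y (l, p) v ∈ U := by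
    intro l p hl hp v
    obtain ⟨⟨h1, h2⟩, h3⟩ := hδs ((hdist l p).2 ⟨hl, hp⟩)
    apply hηU
    rw [Metric.mem_ball]
    exact ((ContinuousMap.dist_apply_le_dist (f := Y (l, p)) (g := constPath p₀) v)).trans_lt
      (h2.trans_le (min_le_right _ _))
  -- Both sides are endpoints of solutions for the parameter `l * s`, and the solution near the
  -- constant path is unique.
  have hscale : ∀ (l : ℝ) (p : V), |l| < δ → dist p p₀ < δ → ∀ s : TimeInterval,
      Y (l, p) s = φ (l * s, p) := by
    intro l p hl hp s
    obtain ⟨⟨h1, h2⟩, h3⟩ := hδs ((hdist l p).2 ⟨hl, hp⟩)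
    have h4 := rescalePath_of_isTrajectory hZU (hYU l p hl hp) h1 s
    have hls : |l * s| ≤ |l| := by
      rw [abs_mul]; exact mul_le_of_le_one_right (abs_nonneg _) (abs_le.2 s.2)
    have h7 := huniq (l * s, p) (rescalePath (Y (l, p)) s)
      (hδs ((hdist (l * s) p).2 ⟨hls.trans_lt hl, hp⟩)).2
      ((ContinuousMap.dist_lt_iff hε).2 fun v =>
        ((ContinuousMap.dist_apply_le_dist (f := Y (l, p)) (g := constPath p₀) _)).trans_lt
          (h2.trans_le (min_le_left _ _))) h4
    change _ = Y (l * s, p) _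
    rw [← h7]
    change _ = Y (l, p) (timeProj (s * 1))
    rw [mul_one, timeProj_coe]
  refine ⟨φ, ?_, ?_, ?_⟩
  · exact hYs.clm (ContinuousMap.evalCLM ℝ (M := V) (⟨1, by norm_num⟩ : TimeInterval))
  · filter_upwards [Metric.ball_mem_nhds ((0 : ℝ), p₀) hδ] with q hq
    obtain ⟨m, p⟩ := q
    obtain ⟨hm, hp⟩ := (hdist m p).1 hq
    -- With `l > |m|` the time `m` lies in the interior of the rescaled interval, so a two-sided
    -- derivative can be taken, also at `m = 0`.
    obtain ⟨l, hml, hlδ⟩ := exists_between hm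
    have hl0 : 0 < l := (abs_nonneg m).trans_lt hml
    have hl : |l| < δ := by rwa [abs_of_pos hl0]
    obtain ⟨⟨h1, h2⟩, h3⟩ := hδs ((hdist l p).2 ⟨hl, hp⟩)
    have hmem : ∀ x : ℝ, |x| < l → x / l ∈ Set.Icc (-1 : ℝ) 1 := fun x hx => by
      rw [Set.mem_Icc, ← abs_le, abs_div, abs_of_pos hl0]
      exact (div_le_one hl0).2 hx.le
    have hval : ∀ x : ℝ, |x| < l → φ (x, p) = Y (l, p) (timeProj (x / l)) := fun x hx => by
      rw [timeProj_of_mem (hmem x hx), hscale l p hl hp ⟨x / l, hmem x hx⟩, mul_div_cancel₀]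
      exact hl0.ne'
    have hcont : Continuous fun u => superpose Z (Y (l, p)) (timeProj u) :=
      (superpose Z (Y (l, p))).continuous.comp continuous_timeProj
    have hev : ∀ᶠ x in 𝓝 m, φ (x, p) =
        p + l • ∫ u in (0 : ℝ)..x / l, superpose Z (Y (l, p)) (timeProj u) := by
      filter_upwards [continuous_abs.continuousAt.eventually (gt_mem_nhds hml)] with x hx
      rw [hval x hx, timeProj_of_mem (hmem x hx)]
      exact congrArg (fun y : C(TimeInterval, V) => y ⟨x / l, hmem x hx⟩) h1
    have hd : HasDerivAt (fun x : ℝ =>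
        p + l • ∫ u in (0 : ℝ)..x / l, superpose Z (Y (l, p)) (timeProj u))
        (Z (φ (m, p))) m := by
      have hi := (hcont.integral_hasStrictDerivAt 0 (m / l)).hasDerivAt
      have hi2 := hi.scomp m ((hasDerivAt_id m).div_const l)
      have hi3 := (hi2.const_smul l).const_add p
      refine hi3.congr_deriv ?_
      rw [superpose_apply hZU (hYU l p hl hp), ← hval m hml, smul_smul, mul_one_div_cancel hl0.ne',
        one_smul]
    exact hd.congr_of_eventuallyEq hev
  · have hc : ContinuousAt (fun p : V => ((0 : ℝ), p)) p₀ := by fun_prop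
    filter_upwards [hc.eventually hY] with p hp
    simp only [zero_smul, add_zero] at hp
    simp only [φ, hp]
    rfl

end LocalFlow

/-! ### The method of characteristics for `Dg · Z = m` -/

set_option maxSynthPendingDepth 3

/-- Flow box: solution of the equation `Dg · Z = m` with the initial condition `g = 0` on a
hyperplane transversal to `Z`. -/
theorem exists_primitive_along {V : Type u} [NormedAddCommGroup V] [NormedSpace ℝ V]
    [CompleteSpace V] {r : WithTop ℕ∞} (hr : r = ∞ ∨ r = ω) {Z : V → V} {m : V → ℝ} {p₀ : V}
    (hZ : SmoothNear r Z p₀) (hm : SmoothNear r m p₀) (l : V →L[ℝ] ℝ) (hl : l (Z p₀) = 1) :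
    ∃ g : V → ℝ, SmoothNear r g p₀ ∧ (∀ᶠ p in 𝓝 p₀, fderiv ℝ g p (Z p) = m p) ∧
      ∀ᶠ p in 𝓝 p₀, l (p - p₀) = 0 → g p = 0 := by
  have hfst : SmoothNear r (fun x : V × ℝ => x.1) (p₀, 0) := contDiff_fst.smoothNear _
  obtain ⟨φ, hφ, hflow, hφ0⟩ := exists_local_flow hr (Z := fun x : V × ℝ => (Z x.1, m x.1))
    (p₀ := (p₀, 0)) ((hZ.comp_of_eq hfst rfl).prodMk (hm.comp_of_eq hfst rfl))
  set e := Z p₀ with he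
  -- `p` is split along `e` into an elapsed time and a starting point on the hyperplane; the extra
  -- coordinate, started at `0`, accumulates the integral of `m` along the trajectory.
  let b : V → ℝ × (V × ℝ) := fun p => (l (p - p₀), (p - l (p - p₀) • e, 0))
  have hbs : ContDiff ℝ r b := by fun_prop
  have hb₀ : b p₀ = (0, (p₀, 0)) := by simp [b]
  let χ : V → V × ℝ := fun p => φ (b p)
  have hχ : SmoothNear r χ p₀ := hφ.comp_of_eq (hbs.smoothNear _) hb₀
  have hb : Tendsto b (𝓝 p₀) (𝓝 (0, (p₀, 0))) := by
    have := hbs.continuous.tendsto p₀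
    rwa [hb₀] at this
  have hbe : ∀ p (s : ℝ), b (p + s • e) = (l (p - p₀) + s, (p - l (p - p₀) • e, 0)) := by
    intro p s
    have h1 : l (p + s • e - p₀) = l (p - p₀) + s := by
      rw [add_sub_right_comm, map_add, map_smul, hl, smul_eq_mul, mul_one]
    simp only [b, h1, add_smul]
    congr 2
    abel
  have hχe : ∀ᶠ p in 𝓝 p₀, fderiv ℝ χ p e = (Z (χ p).1, m (χ p).1) := by
    filter_upwards [hb.eventually hflow, hχ.eventually_differentiableAt hr] with p h1 h2
    have h3 : HasDerivAt (fun s : ℝ => p + s • e) e 0 := by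
      simpa using ((hasDerivAt_id (0 : ℝ)).smul_const e).const_add p
    have h2' : HasFDerivAt χ (fderiv ℝ χ p) (p + (0 : ℝ) • e) := by simpa using h2.hasFDerivAt
    have h4 : HasDerivAt (fun s : ℝ => χ (p + s • e)) (fderiv ℝ χ p e) 0 := by
      have := h2'.comp_hasDerivAt (0 : ℝ) h3
      exact this
    have h5 : HasDerivAt (fun s : ℝ => l (p - p₀) + s) 1 0 :=
      (hasDerivAt_id (0 : ℝ)).const_add _
    have h1' : HasDerivAt (fun s => φ (s, (b p).2)) (Z (χ p).1, m (χ p).1) (l (p - p₀) + 0) := by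
      rw [add_zero]; exact h1
    have h6 := h1'.scomp (0 : ℝ) h5
    rw [one_smul] at h6
    refine h4.unique (h6.congr_of_eventuallyEq (Eventually.of_forall fun s => ?_))
    simp only [χ, hbe]
    rfl
  have hχ0 : ∀ᶠ p in 𝓝 p₀, l (p - p₀) = 0 → χ p = (p, 0) := by
    have hc : Tendsto (fun p : V => (p, (0 : ℝ))) (𝓝 p₀) (𝓝 (p₀, 0)) := by
      have : Continuous (fun p : V => (p, (0 : ℝ))) := by fun_prop
      exact this.tendsto p₀
    filter_upwards [hc.eventually hφ0] with p hp h
    simp only [χ, b, h, zero_smul, sub_zero, hp]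
  have hχp : χ p₀ = (p₀, 0) := hχ0.self_of_nhds (by simp)
  let Ψ : V → V := fun p => (χ p).1
  have hΨ : SmoothNear r Ψ p₀ := hχ.clm (ContinuousLinearMap.fst ℝ V ℝ)
  have hχd := (hχ.differentiableAt hr).hasFDerivAt
  -- The derivative is the identity on `e` by the flow equation and on `ker l` by the initial
  -- condition.
  have hΨ' : HasFDerivAt Ψ ((ContinuousLinearEquiv.refl ℝ V : V ≃L[ℝ] V) : V →L[ℝ] V) p₀ := by
    have h1 : HasFDerivAt Ψ ((ContinuousLinearMap.fst ℝ V ℝ).comp (fderiv ℝ χ p₀)) p₀ :=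
      (ContinuousLinearMap.fst ℝ V ℝ).hasFDerivAt.comp p₀ hχd
    refine h1.congr_fderiv (ContinuousLinearMap.ext fun v => ?_)
    have h2 : (fderiv ℝ χ p₀ e).1 = e := by rw [hχe.self_of_nhds, hχp]
    have h3 : ∀ h, l h = 0 → (fderiv ℝ χ p₀ h).1 = h := by
      intro h hh
      have h3 : HasDerivAt (fun s : ℝ => p₀ + s • h) h 0 := by
        simpa using ((hasDerivAt_id (0 : ℝ)).smul_const h).const_add p₀
      have h1' : HasFDerivAt Ψ ((ContinuousLinearMap.fst ℝ V ℝ).comp (fderiv ℝ χ p₀))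
          (p₀ + (0 : ℝ) • h) := by simpa using h1
      have h4 : HasDerivAt (fun s : ℝ => Ψ (p₀ + s • h)) (fderiv ℝ χ p₀ h).1 0 := by
        have := h1'.comp_hasDerivAt (0 : ℝ) h3
        exact this
      refine h4.unique (h3.congr_of_eventuallyEq ?_)
      have hc : Tendsto (fun s : ℝ => p₀ + s • h) (𝓝 0) (𝓝 p₀) := by
        simpa using h3.continuousAt.tendsto
      filter_upwards [hc.eventually hχ0] with s hs
      have := hs (by simp [hh])
      simp only [Ψ, this]
    have h5 := h3 (v - l v • e) (by simp [hl])
    rw [map_sub, map_smul, Prod.fst_sub, Prod.smul_fst, h2] at h5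
    exact sub_left_inj.1 h5
  obtain ⟨Θ, hΘd, haΘ, hΘ⟩ := hΨ.exists_isLocalDiffeo hr hΨ'
  have hΨp : Ψ p₀ = p₀ := by simp only [Ψ, hχp]
  have hΘp : Θ.symm p₀ = p₀ := by
    have := Θ.left_inv haΘ
    rwa [hΘ, hΨp] at this
  have hpt : p₀ ∈ Θ.target := by
    have := Θ.map_source haΘ
    rwa [hΘ, hΨp] at this
  -- The accumulated integral of `m`, expressed as a function of the endpoint of the trajectory.
  let g : V → ℝ := fun y => (χ (Θ.symm y)).2
  have hsym := hΘd.symm.smoothNear (a := p₀) hpt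
  have hg : SmoothNear r g p₀ :=
    (hχ.comp_of_eq hsym hΘp).clm (ContinuousLinearMap.snd ℝ V ℝ)
  have hback : Tendsto Θ.symm (𝓝 p₀) (𝓝 p₀) := by
    have := hsym.continuousAt.tendsto
    rwa [hΘp] at this
  refine ⟨g, hg, ?_, ?_⟩
  · filter_upwards [hg.eventually_differentiableAt hr, hback.eventually hχe,
      hback.eventually (hχ.eventually_differentiableAt hr), Θ.open_target.mem_nhds hpt]
      with y h1 h2 h3 h4
    have hy : Ψ (Θ.symm y) = y := by rw [← hΘ]; exact Θ.right_inv h4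
    have hsrc := Θ.map_target h4
    have e1 : HasFDerivAt Ψ ((ContinuousLinearMap.fst ℝ V ℝ).comp (fderiv ℝ χ (Θ.symm y)))
        (Θ.symm y) := (ContinuousLinearMap.fst ℝ V ℝ).hasFDerivAt.comp _ h3.hasFDerivAt
    have e2 : HasFDerivAt (fun p => (χ p).2)
        ((ContinuousLinearMap.snd ℝ V ℝ).comp (fderiv ℝ χ (Θ.symm y)))
        (Θ.symm y) := (ContinuousLinearMap.snd ℝ V ℝ).hasFDerivAt.comp _ h3.hasFDerivAt
    have e3 : HasFDerivAt (fun p => g (Ψ p)) ((fderiv ℝ g y).comp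
        ((ContinuousLinearMap.fst ℝ V ℝ).comp (fderiv ℝ χ (Θ.symm y)))) (Θ.symm y) := by
      have h1' : HasFDerivAt g (fderiv ℝ g y) (Ψ (Θ.symm y)) := by rw [hy]; exact h1.hasFDerivAt
      exact h1'.comp (Θ.symm y) e1
    have e4 : (fun p => g (Ψ p)) =ᶠ[𝓝 (Θ.symm y)] fun p => (χ p).2 := by
      filter_upwards [Θ.open_source.mem_nhds hsrc] with p hp
      have := Θ.left_inv hp
      rw [hΘ] at this
      simp only [g, this]
    have e5 := (e3.congr_of_eventuallyEq e4.symm).unique e2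
    have e6 := congrArg (fun L : V →L[ℝ] ℝ => L e) e5
    simp only [ContinuousLinearMap.comp_apply, h2, ContinuousLinearMap.coe_fst',
      ContinuousLinearMap.coe_snd'] at e6
    change fderiv ℝ g y (Z (Ψ (Θ.symm y))) = m (Ψ (Θ.symm y)) at e6
    rwa [hy] at e6
  · filter_upwards [hχ0, Θ.open_source.mem_nhds haΘ] with y h1 h2 h3
    have h4 := Θ.left_inv h2
    have h5 : Θ y = y := by rw [hΘ]; simp only [Ψ, h1 h3]
    rw [h5] at h4
    simp only [g, h4, h1 h3]

/-! ### The Poincaré lemma for 2-forms in the class `C^r` -/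

section Poincare

variable {E : Type u} [NormedAddCommGroup E] [NormedSpace ℝ E]

theorem eventually_fderiv_alternating {F : Type*} [NormedAddCommGroup F] [NormedSpace ℝ F]
    {r : WithTop ℕ∞} (hr : r = ∞ ∨ r = ω)
    {η : F → E →L[ℝ] E →L[ℝ] ℝ} {p : F} (hη : SmoothNear r η p)
    (halt : ∀ᶠ x in 𝓝 p, ∀ u v, η x u v = -η x v u) :
    ∀ᶠ x in 𝓝 p, ∀ a u v, fderiv ℝ η x a u v = -fderiv ℝ η x a v u := by
  filter_upwards [halt.eventually_nhds, hη.eventually_differentiableAt hr] with x h1 h2 a u v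
  have e : ∀ u v : E, HasFDerivAt (fun y => η y u v) (((fderiv ℝ η x).flip u).flip v) x := by
    intro u v
    have h3 := (h2.hasFDerivAt.clm_apply (hasFDerivAt_const u x)).clm_apply (hasFDerivAt_const v x)
    refine h3.congr_fderiv (ContinuousLinearMap.ext fun a => ?_)
    simp only [add_apply, ContinuousLinearMap.comp_apply,
      ContinuousLinearMap.flip_apply, zero_apply, map_zero, zero_add]
  have h4 := (e u v).unique ((e v u).neg.congr_of_eventuallyEq
    (h1.mono fun y hy => hy u v))
  simpa using congrArg (fun L : F →L[ℝ] ℝ => L a) h4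

/-- The ray through `x`, parametrized by `[-1, 1]`. -/
noncomputable def rayPath : E →L[ℝ] C(TimeInterval, E) :=
  LinearMap.mkContinuous
    { toFun := fun x => ⟨fun t => (t : ℝ) • x, by fun_prop⟩
      map_add' := fun _ _ => by ext; simp
      map_smul' := fun c x => by ext t; exact smul_comm _ _ _ } 1 fun x => by
    rw [one_mul]
    refine (ContinuousMap.norm_le _ (by positivity)).2 fun t => ?_
    change ‖(t : ℝ) • x‖ ≤ ‖x‖
    rw [norm_smul]
    exact mul_le_of_le_one_left (norm_nonneg x) (abs_le.2 t.2)

theorem rayPath_apply (x : E) (t : TimeInterval) : rayPath x t = (t : ℝ) • x := rfl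

/-- The weighted mean `∫₀¹ t y(t) dt`. -/
noncomputable def weightedMean {W : Type u} [NormedAddCommGroup W] [NormedSpace ℝ W] :
    C(TimeInterval, W) →L[ℝ] W :=
  ((ContinuousMap.evalCLM ℝ (M := W) (⟨1, by norm_num⟩ : TimeInterval)).comp primitive).comp
    (pointwiseApply ⟨fun t : TimeInterval => (t : ℝ) • ContinuousLinearMap.id ℝ W, by fun_prop⟩)

theorem weightedMean_apply {W : Type u} [NormedAddCommGroup W] [NormedSpace ℝ W]
    (y : C(TimeInterval, W)) :
    weightedMean y = ∫ t in (0 : ℝ)..1, (timeProj t : ℝ) • y (timeProj t) := rfl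

theorem weightedMean_apply₂ (y : C(TimeInterval, E →L[ℝ] E →L[ℝ] ℝ)) (a b : E) :
    weightedMean y a b = ∫ t in (0 : ℝ)..1, (timeProj t : ℝ) * y (timeProj t) a b := by
  have hy : Continuous fun t => (timeProj t : ℝ) • y (timeProj t) :=
    (continuous_subtype_val.comp continuous_timeProj).smul
      (y.continuous.comp continuous_timeProj)
  let L : (E →L[ℝ] E →L[ℝ] ℝ) →L[ℝ] ℝ :=
    (ContinuousLinearMap.apply ℝ ℝ b).comp (ContinuousLinearMap.apply ℝ (E →L[ℝ] ℝ) a)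
  rw [weightedMean_apply]
  exact (L.intervalIntegral_comp_comm (hy.intervalIntegrable 0 1)).symm

/-- A closed `2`-form is recovered from the radial average which is used in the Poincaré lemma. -/
theorem integral_radial_of_closed {η : E → E →L[ℝ] E →L[ℝ] ℝ} {x : E}
    {A : C(TimeInterval, E →L[ℝ] E →L[ℝ] ℝ)} {A' : C(TimeInterval, E →L[ℝ] E →L[ℝ] E →L[ℝ] ℝ)}
    (hA : ∀ t, A t = η ((t : ℝ) • x)) (hA' : ∀ t, A' t = fderiv ℝ η ((t : ℝ) • x))
    (hd : ∀ t : TimeInterval, DifferentiableAt ℝ η ((t : ℝ) • x))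
    (halt : ∀ t u v, A t u v = -A t v u) (halt' : ∀ t a u v, A' t a u v = -A' t a v u)
    (hclosed : ∀ t u v w, A' t u v w + A' t v w u + A' t w u v = 0) (u v : E) :
    (∫ t in (0 : ℝ)..1, (timeProj t : ℝ) * A' (timeProj t) ((timeProj t : ℝ) • u) x v) +
      (∫ t in (0 : ℝ)..1, (timeProj t : ℝ) * A (timeProj t) u v) -
      ((∫ t in (0 : ℝ)..1, (timeProj t : ℝ) * A' (timeProj t) ((timeProj t : ℝ) • v) x u) +
      (∫ t in (0 : ℝ)..1, (timeProj t : ℝ) * A (timeProj t) v u)) = η x u v := by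
  have hproj : Continuous fun t => (timeProj t : ℝ) :=
    continuous_subtype_val.comp continuous_timeProj
  have hcA : Continuous fun t => A (timeProj t) := A.continuous.comp continuous_timeProj
  have hcA' : Continuous fun t => A' (timeProj t) := A'.continuous.comp continuous_timeProj
  have hi : ∀ a b, Continuous fun t => (timeProj t : ℝ) * A (timeProj t) a b := fun a b =>
    hproj.mul ((hcA.clm_apply continuous_const).clm_apply continuous_const)
  have hi' : ∀ a b c, Continuous fun t =>
      (timeProj t : ℝ) * A' (timeProj t) ((timeProj t : ℝ) • a) b c := fun a b c =>
    hproj.mul (((hcA'.clm_apply (hproj.smul continuous_const)).clm_apply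
      continuous_const).clm_apply continuous_const)
  have hii : ∀ a b c d e, Continuous fun t =>
      (timeProj t : ℝ) * A' (timeProj t) ((timeProj t : ℝ) • a) b c +
        (timeProj t : ℝ) * A (timeProj t) d e := fun a b c d e => (hi' a b c).add (hi d e)
  rw [← intervalIntegral.integral_add ((hi' _ _ _).intervalIntegrable _ _)
    ((hi _ _).intervalIntegrable _ _), ← intervalIntegral.integral_add
    ((hi' _ _ _).intervalIntegrable _ _) ((hi _ _).intervalIntegrable _ _),
    ← intervalIntegral.integral_sub ((hii _ _ _ _ _).intervalIntegrable _ _)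
    ((hii _ _ _ _ _).intervalIntegrable _ _)]
  have hmem : ∀ t ∈ Set.uIcc (0 : ℝ) 1, t ∈ Set.Icc (-1 : ℝ) 1 := fun t ht => by
    rw [Set.uIcc_of_le zero_le_one] at ht
    exact ⟨by linarith [ht.1], ht.2⟩
  -- By closedness and antisymmetry the integrand is the derivative of `t² η(t x)(u, v)`, whose
  -- values at `1` and `0` are `η x u v` and `0`.
  have hder : ∀ t ∈ Set.uIcc (0 : ℝ) 1, HasDerivAt (fun t : ℝ => t ^ 2 * η (t • x) u v)
      (2 * (timeProj t : ℝ) * A (timeProj t) u v + (timeProj t : ℝ) ^ 2 * A' (timeProj t) x u v)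
      t := by
    intro t ht
    have h1 : HasDerivAt (fun t : ℝ => t • x) x t := by
      simpa using (hasDerivAt_id t).smul_const x
    have h2 : HasDerivAt (fun t : ℝ => η (t • x)) (fderiv ℝ η (t • x) x) t :=
      (hd ⟨t, hmem t ht⟩).hasFDerivAt.comp_hasDerivAt t h1
    have h3 := (h2.clm_apply (hasDerivAt_const t u)).clm_apply (hasDerivAt_const t v)
    refine ((hasDerivAt_pow 2 t).mul h3).congr_deriv ?_
    rw [timeProj_of_mem (hmem t ht), hA, hA']
    simp
  have hint := intervalIntegral.integral_eq_sub_of_hasDerivAt hder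
    (Continuous.intervalIntegrable (((hproj.const_mul 2).mul
      ((hcA.clm_apply continuous_const).clm_apply continuous_const)).add ((hproj.pow 2).mul
      (((hcA'.clm_apply continuous_const).clm_apply continuous_const).clm_apply
      continuous_const))) _ _)
  simp only [one_pow, one_smul, one_mul, ne_eq, OfNat.ofNat_ne_zero, not_false_eq_true,
    zero_pow, zero_mul, sub_zero] at hint
  rw [← hint]
  refine intervalIntegral.integral_congr fun t _ => ?_
  simp only [map_smul, smul_apply, smul_eq_mul]
  rw [halt _ v u]
  linear_combination (timeProj t : ℝ) ^ 2 * hclosed (timeProj t) v u x -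
    (timeProj t : ℝ) ^ 2 * halt' (timeProj t) v u x - (timeProj t : ℝ) ^ 2 * halt' (timeProj t) x u v

/-- The radial average `x ↦ ∫₀¹ t η(t x) dt`. -/
noncomputable def radialMean {W : Type u} [NormedAddCommGroup W] [NormedSpace ℝ W] (η : E → W)
    (x : E) : W := weightedMean (superpose η (rayPath x))

/-- The average is a composition of a linear map, a superposition operator and a linear map, so no
separate argument on parameter-dependent integrals is needed in the analytic case. -/
theorem SmoothNear.radialMean {W : Type u} [NormedAddCommGroup W] [NormedSpace ℝ W]
    [CompleteSpace W] {r : WithTop ℕ∞} (hr : r = ∞ ∨ r = ω) {η : E → W} (hη : SmoothNear r η 0) :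
    SmoothNear r (radialMean η) 0 := by
  have hray0 : rayPath (0 : E) = ContinuousMap.const TimeInterval 0 := by
    ext t; exact smul_zero _
  have hsup : SmoothNear r (superpose (K := TimeInterval) η) (ContinuousMap.const _ 0) :=
    smoothNear_superpose hr hη
  have hpath : SmoothNear r (fun x : E => rayPath x) 0 :=
    (smoothNear_id (0 : E)).clm (rayPath (E := E))
  exact (hsup.comp_of_eq hpath hray0).clm weightedMean

theorem hasFDerivAt_radialMean {W : Type u} [NormedAddCommGroup W] [NormedSpace ℝ W] {η : E → W}
    {U : Set E} (hU : IsOpen U) (hη : ContDiffOn ℝ 1 η U) {x : E}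
    (hx : ∀ t : TimeInterval, (t : ℝ) • x ∈ U) :
    HasFDerivAt (radialMean η) (weightedMean.comp
      ((pointwiseApply (superpose (fderiv ℝ η) (rayPath x))).comp rayPath)) x := by
  have h1 : HasFDerivAt (fun x : E => rayPath x) (rayPath (E := E)) x :=
    (rayPath (E := E)).hasFDerivAt
  have h2 := (hasFDerivAt_superpose hU hη (y := rayPath x) hx).comp x h1
  exact (weightedMean (W := W)).hasFDerivAt.comp x h2

/-- The Poincaré lemma for `2`-forms of class `C^r`, with a primitive vanishing at `0`. -/
theorem exists_primitive_of_closed {r : WithTop ℕ∞} (hr : r = ∞ ∨ r = ω)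
    {η : E → E →L[ℝ] E →L[ℝ] ℝ} (hη : SmoothNear r η 0)
    (halt : ∀ᶠ x in 𝓝 0, ∀ u v, η x u v = -η x v u)
    (hclosed : ∀ᶠ x in 𝓝 0, ∀ u v w,
      fderiv ℝ η x u v w + fderiv ℝ η x v w u + fderiv ℝ η x w u v = 0) :
    ∃ α : E → E →L[ℝ] ℝ, SmoothNear r α 0 ∧ α 0 = 0 ∧ (η 0 = 0 → fderiv ℝ α 0 = 0) ∧
      ∀ᶠ x in 𝓝 0, ∀ u v, fderiv ℝ α x u v - fderiv ℝ α x v u = η x u v := by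
  have hM := hη.radialMean hr
  obtain ⟨ρ, hρ, hball⟩ := Metric.eventually_nhds_iff_ball.1
    (hη.and (halt.and ((eventually_fderiv_alternating hr hη halt).and hclosed)))
  have hη1 : ContDiffOn ℝ 1 η (Metric.ball 0 ρ) := fun x hx =>
    ((hball x hx).1.of_le (one_le_of_infty_or_omega hr)).contDiffWithinAt
  have hηd : ContinuousOn (fderiv ℝ η) (Metric.ball 0 ρ) :=
    hη1.continuousOn_fderiv_of_isOpen Metric.isOpen_ball le_rfl
  have hmem : ∀ x ∈ Metric.ball (0 : E) ρ, ∀ t : TimeInterval,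
      (t : ℝ) • x ∈ Metric.ball (0 : E) ρ := by
    intro x hx t
    rw [mem_ball_zero_iff] at hx ⊢
    rw [norm_smul]
    exact (mul_le_of_le_one_left (norm_nonneg x) (abs_le.2 t.2)).trans_lt hx
  have hMd : ∀ x ∈ Metric.ball (0 : E) ρ, ∀ a, fderiv ℝ (fun x => radialMean η x x) x a =
      weightedMean (pointwiseApply (superpose (fderiv ℝ η) (rayPath x)) (rayPath a)) x +
        radialMean η x a := by
    intro x hx a
    have h := (hasFDerivAt_radialMean Metric.isOpen_ball hη1 (hmem x hx)).clm_apply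
      (hasFDerivAt_id x)
    have h' : HasFDerivAt (fun x => radialMean η x x) _ x := h
    rw [h'.fderiv]
    simp only [add_apply, ContinuousLinearMap.comp_apply,
      ContinuousLinearMap.flip_apply, ContinuousLinearMap.id_apply, id_eq]
    exact add_comm _ _
  -- The classical primitive `α(x) = ∫₀¹ t η(t x)(x, ·) dt`. If `η 0 = 0`, both factors vanish at
  -- `0`, hence so does the first derivative of `α`.
  refine ⟨fun x => radialMean η x x, hM.clm_apply (smoothNear_id 0), map_zero _, fun h0 => ?_, ?_⟩
  · have hM0 : radialMean η 0 = 0 := by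
      have : superpose η (rayPath (0 : E)) = 0 := by
        ext1 t
        rw [superpose_apply hη1.continuousOn (hmem 0 (Metric.mem_ball_self hρ)), rayPath_apply,
          smul_zero, h0]
        rfl
      change weightedMean (superpose η (rayPath 0)) = 0
      rw [this, map_zero]
    ext a b
    rw [hMd 0 (Metric.mem_ball_self hρ), hM0]
    simp only [map_zero, zero_apply, add_zero]
  · filter_upwards [Metric.ball_mem_nhds (0 : E) hρ] with x hx u v
    have hA : ∀ t, superpose η (rayPath x) t = η ((t : ℝ) • x) :=
      superpose_apply hη1.continuousOn (hmem x hx)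
    have hA' : ∀ t, superpose (fderiv ℝ η) (rayPath x) t = fderiv ℝ η ((t : ℝ) • x) :=
      superpose_apply hηd (hmem x hx)
    have hfd : ∀ a b, fderiv ℝ (fun x => radialMean η x x) x a b =
        (∫ t in (0 : ℝ)..1, (timeProj t : ℝ) * superpose (fderiv ℝ η) (rayPath x) (timeProj t)
          ((timeProj t : ℝ) • a) x b) +
        ∫ t in (0 : ℝ)..1, (timeProj t : ℝ) * superpose η (rayPath x) (timeProj t) a b := by
      intro a b
      rw [hMd x hx, radialMean, add_apply, weightedMean_apply₂, weightedMean_apply₂]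
      rfl
    rw [hfd, hfd]
    refine integral_radial_of_closed (η := η) (A := superpose η (rayPath x))
      (A' := superpose (fderiv ℝ η) (rayPath x)) hA hA' (fun t => ?_) (fun t => ?_) (fun t => ?_)
      (fun t => ?_) u v
    · exact (hball _ (hmem x hx t)).1.differentiableAt (ne_zero_of_infty_or_omega hr)
    · rw [hA]; exact (hball _ (hmem x hx t)).2.1
    · rw [hA']; exact (hball _ (hmem x hx t)).2.2.1
    · rw [hA']; exact (hball _ (hmem x hx t)).2.2.2

end Poincare

theorem exists_equiv_of_injective {U : Type*} [NormedAddCommGroup U] [NormedSpace ℝ U]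
    [FiniteDimensional ℝ U] (A : U →L[ℝ] U →L[ℝ] ℝ) (hA : ∀ u, (∀ v, A u v = 0) → u = 0) :
    ∃ e : U ≃L[ℝ] (U →L[ℝ] ℝ), A = e := by
  have hinj : Function.Injective (A : U →ₗ[ℝ] (U →L[ℝ] ℝ)) := by
    rw [← LinearMap.ker_eq_bot, LinearMap.ker_eq_bot']
    intro u hu
    exact hA u fun v => by
      have : A u = 0 := hu
      rw [this]; rfl
  have hdim : Module.finrank ℝ U = Module.finrank ℝ (U →L[ℝ] ℝ) := by
    rw [← (LinearMap.toContinuousLinearMap (𝕜 := ℝ) (E := U) (F' := ℝ)).finrank_eq]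
    exact (Subspace.dual_finrank_eq (K := ℝ) (V := U)).symm
  let e := LinearEquiv.ofInjectiveOfFinrankEq (A : U →ₗ[ℝ] (U →L[ℝ] ℝ)) hinj hdim
  refine ⟨e.toContinuousLinearEquiv, ?_⟩
  ext u v
  rfl

/-! ### Differentials in the space variable at fixed time -/

section PartialDiff

variable {E : Type u} [NormedAddCommGroup E] [NormedSpace ℝ E] {r : WithTop ℕ∞}

/-- The partial differential of a function on `ℝ × E` in the direction of `E`. -/
noncomputable def partialDiff (g : ℝ × E → ℝ) (q : ℝ × E) : E →L[ℝ] ℝ :=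
  (fderiv ℝ g q).comp (ContinuousLinearMap.inr ℝ ℝ E)

theorem partialDiff_apply (g : ℝ × E → ℝ) (q : ℝ × E) (v : E) :
    partialDiff g q v = fderiv ℝ g q (0, v) := rfl

theorem SmoothNear.partialDiff (hr : r = ∞ ∨ r = ω) {g : ℝ × E → ℝ} {q : ℝ × E}
    (hg : SmoothNear r g q) : SmoothNear r (partialDiff g) q :=
  (hg.fderiv hr).clm_comp (smoothNear_const _ q)

end PartialDiff

/-! ### Correcting the primitive along one stratum -/

section Stratum

variable {E : Type u} [NormedAddCommGroup E] [NormedSpace ℝ E] [FiniteDimensional ℝ E]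

/-- A family of `2`-forms which is nondegenerate on a subspace `H` provides a solution operator `T`
for the equation `η(T ξ, h) = ξ(h)`, `h ∈ H`, with values in `H`. -/
theorem exists_solution_operator {F : Type*} [NormedAddCommGroup F] [NormedSpace ℝ F]
    {r : WithTop ℕ∞} {η : F → E →L[ℝ] E →L[ℝ] ℝ} {q₀ : F} (hη : SmoothNear r η q₀)
    (H : Submodule ℝ E) (hH : ∀ u ∈ H, (∀ v ∈ H, η q₀ u v = 0) → u = 0) :
    ∃ T : F → (E →L[ℝ] ℝ) →L[ℝ] E, SmoothNear r T q₀ ∧ (∀ q ξ, T q ξ ∈ H) ∧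
      (∀ q ξ, (∀ v ∈ H, ξ v = 0) → T q ξ = 0) ∧
      (∀ᶠ q in 𝓝 q₀, ∀ ξ, ∀ v ∈ H, η q (T q ξ) v = ξ v) ∧
      ∀ᶠ q in 𝓝 q₀, ∀ u ∈ H, T q (η q u) = u := by
  let R : (E →L[ℝ] ℝ) →L[ℝ] (H →L[ℝ] ℝ) := (ContinuousLinearMap.compL ℝ H E ℝ).flip H.subtypeL
  let A : F → H →L[ℝ] H →L[ℝ] ℝ := fun q => R.comp ((η q).comp H.subtypeL)
  have hA : SmoothNear r A q₀ :=
    (smoothNear_const R q₀).clm_comp (hη.clm_comp (smoothNear_const H.subtypeL q₀))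
  obtain ⟨e, he⟩ := exists_equiv_of_injective (A q₀) fun u hu =>
    Subtype.ext (hH u u.2 fun v hv => hu ⟨v, hv⟩)
  obtain ⟨hinv, hev⟩ := hA.inverse e he
  refine ⟨fun q => H.subtypeL.comp ((A q).inverse.comp R),
    (smoothNear_const _ q₀).clm_comp (hinv.clm_comp (smoothNear_const R q₀)),
    fun q ξ => ((A q).inverse (R ξ)).2, fun q ξ hξ => ?_, ?_, ?_⟩
  · have : R ξ = 0 := ContinuousLinearMap.ext fun v => hξ v v.2
    change (((A q).inverse (R ξ) : H) : E) = 0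
    rw [this, map_zero]
    rfl
  · filter_upwards [hev] with q ⟨e', he'⟩ ξ v hv
    have h1 : A q ((A q).inverse (R ξ)) = R ξ := by
      rw [he', ContinuousLinearMap.inverse_equiv]
      exact e'.apply_symm_apply _
    exact congrArg (fun f : H →L[ℝ] ℝ => f ⟨v, hv⟩) h1
  · filter_upwards [hev] with q ⟨e', he'⟩ u hu
    have h1 : (A q).inverse (A q ⟨u, hu⟩) = ⟨u, hu⟩ := by
      rw [he', ContinuousLinearMap.inverse_equiv]
      exact e'.symm_apply_apply _
    exact congrArg Subtype.val h1

/-- The normal form of the restriction of a `2`-form `η` to `L`: it is nondegenerate on `H`, and `L`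
is either `H` or the sum of `H` and a line which is orthogonal to `H`. -/
structure IsMaximalRankSplitting (η : E →L[ℝ] E →L[ℝ] ℝ) (L H : Submodule ℝ E) : Prop where
  le : H ≤ L
  nondegenerate : ∀ u ∈ H, (∀ v ∈ H, η u v = 0) → u = 0
  eq_or_exists : L = H ∨ ∃ e ∈ L, e ≠ 0 ∧ (∀ v ∈ L, ∃ h ∈ H, ∃ c : ℝ, v = h + c • e) ∧
    ∀ h ∈ H, η e h = 0

variable {r : WithTop ℕ∞}

/-- A function vanishing on the hyperplane `l = 0` has vanishing derivatives along it. -/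
theorem eventually_fderiv_eq_zero_of_vanish {E W : Type*} [NormedAddCommGroup E] [NormedSpace ℝ E]
    [NormedAddCommGroup W] [NormedSpace ℝ W] {r : WithTop ℕ∞} (hr : r = ∞ ∨ r = ω) (l : E →L[ℝ] ℝ)
    (f : ℝ × E → W) {t₀ : ℝ} (hf : SmoothNear r f (t₀, 0))
    (hf0 : ∀ᶠ q in 𝓝 (t₀, (0 : E)), l q.2 = 0 → f q = 0) :
    ∀ᶠ q in 𝓝 (t₀, (0 : E)), l q.2 = 0 → ∀ h, l h = 0 → fderiv ℝ f q (0, h) = 0 := by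
  filter_upwards [hf.eventually_differentiableAt hr, hf0.eventually_nhds] with q h1 h2 hq h hh
  have hline : HasDerivAt (fun s : ℝ => q + s • ((0 : ℝ), h)) (0, h) 0 := by
    simpa using ((hasDerivAt_id (0 : ℝ)).smul_const ((0 : ℝ), h)).const_add q
  have hlim : Tendsto (fun s : ℝ => q + s • ((0 : ℝ), h)) (𝓝 0) (𝓝 q) := by
    simpa using hline.continuousAt.tendsto
  have h1' : HasFDerivAt f (fderiv ℝ f q) (q + (0 : ℝ) • ((0 : ℝ), h)) := by
    simpa using h1.hasFDerivAt
  have h3 := h1'.comp_hasDerivAt (0 : ℝ) hline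
  refine h3.unique ((hasDerivAt_const (0 : ℝ) (0 : W)).congr_of_eventuallyEq ?_)
  filter_upwards [hlim.eventually h2] with s hs
  exact hs (by simp [hq, hh])

/-- Solution of `Dg · K = m` whose derivatives of order at most two in the direction of `E` vanish
at the points `(t, 0)`. -/
theorem exists_flat_primitive_along (hr : r = ∞ ∨ r = ω) {K : ℝ × E → E} {m : ℝ × E → ℝ} {t₀ : ℝ}
    (hK : SmoothNear r K (t₀, 0)) (hm : SmoothNear r m (t₀, 0)) {e : E} (he : e ≠ 0)
    (hK0 : ∀ᶠ q in 𝓝 (t₀, (0 : E)), q.2 = 0 → K q = e)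
    (hm0 : ∀ᶠ q in 𝓝 (t₀, (0 : E)), q.2 = 0 → m q = 0 ∧ ∀ u, fderiv ℝ m q (0, u) = 0) :
    ∃ g : ℝ × E → ℝ, SmoothNear r g (t₀, 0) ∧
      (∀ᶠ q in 𝓝 (t₀, (0 : E)), partialDiff g q (K q) = m q) ∧
      ∀ᶠ q in 𝓝 (t₀, (0 : E)), q.2 = 0 →
        partialDiff g q = 0 ∧ ∀ u, fderiv ℝ (partialDiff g) q (0, u) = 0 := by
  obtain ⟨l, hl⟩ : ∃ l : E →L[ℝ] ℝ, l e = 1 := by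
    obtain ⟨l, hl⟩ := SeparatingDual.exists_eq_one (R := ℝ) he
    exact ⟨l, hl⟩
  obtain ⟨g, hg, hgK, hg0⟩ := exists_primitive_along hr (V := ℝ × E)
    (Z := fun q => ((0 : ℝ), K q)) (m := m) ((smoothNear_const 0 _).prodMk hK) hm
    (l.comp (ContinuousLinearMap.snd ℝ ℝ E)) (by
      change l (K (t₀, 0)) = 1
      rw [hK0.self_of_nhds rfl, hl])
  have hg0' : ∀ᶠ q in 𝓝 (t₀, (0 : E)), l q.2 = 0 → g q = 0 := by
    filter_upwards [hg0] with q hq h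
    exact hq (by simpa using h)
  have hsplit : ∀ u : E, u = l u • e + (u - l u • e) := fun u => by abel
  have hlsplit : ∀ u : E, l (u - l u • e) = 0 := fun u => by simp [hl]
  have hpd := hg.partialDiff hr
  have hfirst := eventually_fderiv_eq_zero_of_vanish hr l g hg hg0'
  have hpd0 : ∀ᶠ q in 𝓝 (t₀, (0 : E)), q.2 = 0 → partialDiff g q = 0 := by
    filter_upwards [hgK, hfirst, hK0, hm0] with q h1 h2 h3 h4 hq
    ext u
    rw [h3 hq, (h4 hq).1] at h1
    rw [hsplit u, map_add, map_smul, partialDiff_apply, partialDiff_apply, h1,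
      h2 (by simp [hq]) _ (hlsplit u)]
    simp
  -- `Q` projects onto `ker l` along `e`. The Hessian of `g` at `(t, 0)` is shown to vanish on pairs
  -- from `ker l`, because `g` vanishes on the hyperplane, and on pairs containing `e`; symmetry
  -- does the rest.
  let Q : E →L[ℝ] E := ContinuousLinearMap.id ℝ E - l.smulRight e
  have hQ : ∀ u, Q u = u - l u • e := fun u => rfl
  have hsecond := eventually_fderiv_eq_zero_of_vanish hr l (fun q => (partialDiff g q).comp Q)
    (hpd.clm_comp (smoothNear_const Q _)) (by
      filter_upwards [hfirst] with q hq h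
      ext u
      exact hq h _ (hlsplit u))
  refine ⟨g, hg, hgK, ?_⟩
  filter_upwards [hpd0, hsecond, hg, hpd.eventually_differentiableAt hr,
    (hg.fderiv hr).eventually_differentiableAt hr, hgK.eventually_nhds,
    hK.eventually_differentiableAt hr, hK0, hm0] with q h1 h2 h3 h4 h5 h6 h7 h8 h9 hq
  refine ⟨h1 hq, fun u => ?_⟩
  have hD : fderiv ℝ (partialDiff g) q =
      ((ContinuousLinearMap.compL ℝ E (ℝ × E) ℝ).flip (ContinuousLinearMap.inr ℝ ℝ E)).comp
        (fderiv ℝ (fderiv ℝ g) q) :=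
    (((ContinuousLinearMap.compL ℝ E (ℝ × E) ℝ).flip
      (ContinuousLinearMap.inr ℝ ℝ E)).hasFDerivAt.comp q h5.hasFDerivAt).fderiv
  have hDa : ∀ w v, fderiv ℝ (partialDiff g) q w v = fderiv ℝ (fderiv ℝ g) q w (0, v) := by
    intro w v; rw [hD]; rfl
  have hsymm : ∀ u v, fderiv ℝ (partialDiff g) q (0, u) v =
      fderiv ℝ (partialDiff g) q (0, v) u := by
    intro u v
    rw [hDa, hDa]
    exact (h3.isSymmSndFDerivAt (minSmoothness_le_of_infty_or_omega hr)).eq _ _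
  -- Differentiate `Dg · K = m` at `(t, 0)`: there `Dg` and `Dm` vanish in the space directions and
  -- `K = e`, so only the Hessian term survives.
  have hDe : ∀ u, fderiv ℝ (partialDiff g) q (0, u) e = 0 := by
    intro u
    have e1 := h4.hasFDerivAt.clm_apply h7.hasFDerivAt
    have e2 := (e1.congr_of_eventuallyEq (h6.mono fun x hx => hx.symm)).fderiv
    have e3 := congrArg (fun L : ℝ × E →L[ℝ] ℝ => L (0, u)) e2
    simp only [add_apply, ContinuousLinearMap.comp_apply, ContinuousLinearMap.flip_apply,
      h1 hq, zero_apply, zero_add, h8 hq, (h9 hq).2] at e3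
    exact e3.symm
  have hDQ : ∀ h, l h = 0 → ∀ v, fderiv ℝ (partialDiff g) q (0, h) (Q v) = 0 := by
    intro h hh v
    have e1 := (h4.hasFDerivAt.clm_comp (hasFDerivAt_const Q q)).fderiv
    have e2 := h2 (by simp [hq]) h hh
    rw [e1] at e2
    simpa using congrArg (fun L : E →L[ℝ] ℝ => L v) e2
  ext v
  calc fderiv ℝ (partialDiff g) q (0, u) v
      = fderiv ℝ (partialDiff g) q (0, u) (l v • e + Q v) := by rw [hQ, ← hsplit]
    _ = fderiv ℝ (partialDiff g) q (0, Q v) u := by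
        rw [map_add, map_smul, hDe, smul_zero, zero_add, hsymm]
    _ = fderiv ℝ (partialDiff g) q (0, Q v) (l u • e + Q u) := by rw [hQ u, ← hsplit]
    _ = 0 := by
        rw [map_add, map_smul, hDe, smul_zero, zero_add]
        exact hDQ _ (hlsplit v) u

/-- The characteristic direction `K` of a stratum `L`, and a function `g` correcting the primitive
`α` in this direction. In the symplectic case both vanish. -/
theorem exists_characteristic_correction (hr : r = ∞ ∨ r = ω)
    {η : ℝ × E → E →L[ℝ] E →L[ℝ] ℝ} {t₀ : ℝ} (hη : SmoothNear r η (t₀, 0))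
    (hconst : ∀ᶠ q in 𝓝 (t₀, (0 : E)), q.2 = 0 → η q = η (t₀, 0))
    {L H : Submodule ℝ E} (hLH : IsMaximalRankSplitting (η (t₀, 0)) L H)
    {α : E → E →L[ℝ] ℝ} (hα : SmoothNear r α 0) (hα0 : α 0 = 0) (hα1 : fderiv ℝ α 0 = 0) :
    ∃ (g : ℝ × E → ℝ) (K : ℝ × E → E), SmoothNear r g (t₀, 0) ∧
      (∀ᶠ q in 𝓝 (t₀, (0 : E)), α q.2 (K q) + partialDiff g q (K q) = 0) ∧
      (∀ᶠ q in 𝓝 (t₀, (0 : E)), q.2 = 0 →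
        partialDiff g q = 0 ∧ ∀ u, fderiv ℝ (partialDiff g) q (0, u) = 0) ∧
      (∀ᶠ q in 𝓝 (t₀, (0 : E)), ∀ h ∈ H, η q (K q) h = 0) ∧
      ∀ q, K q ∈ L ∧ ∀ v ∈ L, ∃ h ∈ H, ∃ c : ℝ, v = h + c • K q := by
  rcases hLH.eq_or_exists with rfl | ⟨e, heL, he, hspan, hperp⟩
  · have h0 : partialDiff (fun _ : ℝ × E => (0 : ℝ)) = 0 := by
      ext q v; simp [partialDiff_apply]
    refine ⟨fun _ => 0, fun _ => 0, smoothNear_const _ _, by simp, ?_, by simp, fun q =>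
      ⟨L.zero_mem, fun v hv => ⟨v, hv, 0, by simp⟩⟩⟩
    refine Eventually.of_forall fun q _ => ⟨by rw [h0]; rfl, fun u => ?_⟩
    rw [h0, show (0 : ℝ × E → E →L[ℝ] ℝ) = fun _ => 0 from rfl]
    simp
  · obtain ⟨T, hT, hTH, hT0, hTs, -⟩ := exists_solution_operator hη H hLH.nondegenerate
    -- Away from the origin `e` need not be orthogonal to `H`; subtracting the `H`-component found
    -- by `T` restores orthogonality. At `x = 0` nothing is subtracted.
    let K : ℝ × E → E := fun q => e - T q (η q e)
    have hK : SmoothNear r K (t₀, 0) := (smoothNear_const e _).sub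
      (hT.clm_apply (hη.clm_apply (smoothNear_const e _)))
    have hK0 : ∀ᶠ q in 𝓝 (t₀, (0 : E)), q.2 = 0 → K q = e := by
      filter_upwards [hconst] with q hq h
      have : T q (η q e) = 0 := hT0 q _ fun v hv => by rw [hq h]; exact hperp v hv
      simp only [K, this, sub_zero]
    have hsnd : SmoothNear r (fun q : ℝ × E => q.2) (t₀, 0) := contDiff_snd.smoothNear _
    have hα2 : SmoothNear r (fun q : ℝ × E => α q.2) (t₀, 0) := hα.comp_of_eq hsnd rfl
    have hm : SmoothNear r (fun q => -α q.2 (K q)) (t₀, 0) := (hα2.clm_apply hK).neg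
    have hm0 : ∀ᶠ q in 𝓝 (t₀, (0 : E)), q.2 = 0 →
        -α q.2 (K q) = 0 ∧ ∀ u, fderiv ℝ (fun q => -α q.2 (K q)) q (0, u) = 0 := by
      filter_upwards [hK.eventually_differentiableAt hr] with q hq h
      refine ⟨by rw [h, hα0]; simp, fun u => ?_⟩
      have e1 : HasFDerivAt (fun q : ℝ × E => α q.2)
          ((0 : E →L[ℝ] E →L[ℝ] ℝ).comp (ContinuousLinearMap.snd ℝ ℝ E)) q := by
        have : HasFDerivAt α (0 : E →L[ℝ] E →L[ℝ] ℝ) q.2 := by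
          rw [h, ← hα1]; exact (hα.differentiableAt hr).hasFDerivAt
        exact this.comp q hasFDerivAt_snd
      have e2 : HasFDerivAt (fun q => -α q.2 (K q)) _ q := (e1.clm_apply hq.hasFDerivAt).neg
      rw [e2.fderiv]
      simp [h, hα0]
    obtain ⟨g, hg, hgK, hg0⟩ := exists_flat_primitive_along hr hK hm he hK0 hm0
    refine ⟨g, K, hg, ?_, hg0, ?_, fun q => ⟨L.sub_mem heL (hLH.le (hTH q _)), fun v hv => ?_⟩⟩
    · filter_upwards [hgK] with q hq
      rw [hq]; ring
    · filter_upwards [hTs] with q hq h hh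
      simp only [K, map_sub, sub_apply, hq _ h hh, sub_self]
    · obtain ⟨h, hh, c, rfl⟩ := hspan v hv
      refine ⟨h + c • T q (η q e), H.add_mem hh (H.smul_mem c (hTH q _)), c, ?_⟩
      simp only [K, smul_sub]
      abel

/-- Along a stratum `L` of maximal rank the primitive `α` can be corrected by the differential of a
function `f` such that the dual vector field is tangent to `L`, without changing it along the
complementary directions. -/
theorem exists_stratum_correction (hr : r = ∞ ∨ r = ω)
    {η : ℝ × E → E →L[ℝ] E →L[ℝ] ℝ} {t₀ : ℝ} (hη : SmoothNear r η (t₀, 0))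
    (halt : ∀ᶠ q in 𝓝 (t₀, (0 : E)), ∀ u v, η q u v = -η q v u)
    (hconst : ∀ᶠ q in 𝓝 (t₀, (0 : E)), q.2 = 0 → η q = η (t₀, 0))
    {L H : Submodule ℝ E} (hLH : IsMaximalRankSplitting (η (t₀, 0)) L H)
    {P : E →L[ℝ] E} (hP : ∀ v, P v ∈ L) (hPL : ∀ v ∈ L, P v = v)
    {α : E → E →L[ℝ] ℝ} (hα : SmoothNear r α 0) (hα0 : α 0 = 0) (hα1 : fderiv ℝ α 0 = 0) :
    ∃ f : ℝ × E → ℝ, SmoothNear r f (t₀, 0) ∧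
      (∀ᶠ q in 𝓝 (t₀, (0 : E)), q.2 ∈ L →
        ∃ Y ∈ L, ∀ v, α q.2 v + partialDiff f q v = -η q Y v) ∧
      ∀ᶠ q in 𝓝 (t₀, (0 : E)), P q.2 = 0 → partialDiff f q = 0 := by
  obtain ⟨g, K, hg, hgK, hg0, hKH, hKL⟩ := exists_characteristic_correction hr hη hconst hLH hα hα0 hα1
  obtain ⟨T, hT, hTH, -, hTs, -⟩ := exists_solution_operator hη H hLH.nondegenerate
  have hsnd : SmoothNear r (fun q : ℝ × E => q.2) (t₀, 0) := contDiff_snd.smoothNear _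
  have hα2 : SmoothNear r (fun q : ℝ × E => α q.2) (t₀, 0) := hα.comp_of_eq hsnd rfl
  have hpd := hg.partialDiff hr
  -- `dg` is composed with `P` because `g` will enter the correction only through its restriction to
  -- `L`.
  let w : ℝ × E → E →L[ℝ] ℝ := fun q => α q.2 + (partialDiff g q).comp P
  have hw : SmoothNear r w (t₀, 0) := hα2.add (hpd.clm_comp (smoothNear_const P _))
  have hw0 : ∀ᶠ q in 𝓝 (t₀, (0 : E)), q.2 = 0 → w q = 0 ∧ ∀ u, fderiv ℝ w q (0, u) = 0 := by
    filter_upwards [hg0, hpd.eventually_differentiableAt hr] with q h1 h2 hq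
    refine ⟨by simp [w, hq, hα0, (h1 hq).1], fun u => ?_⟩
    have e1 : HasFDerivAt (fun q : ℝ × E => α q.2)
        ((0 : E →L[ℝ] E →L[ℝ] ℝ).comp (ContinuousLinearMap.snd ℝ ℝ E)) q := by
      have : HasFDerivAt α (0 : E →L[ℝ] E →L[ℝ] ℝ) q.2 := by
        rw [hq, ← hα1]; exact (hα.differentiableAt hr).hasFDerivAt
      exact this.comp q hasFDerivAt_snd
    have e2 := e1.add (h2.hasFDerivAt.clm_comp (hasFDerivAt_const P q))
    have e3 : HasFDerivAt w _ q := e2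
    rw [e3.fderiv]
    ext v
    simp [(h1 hq).2]
  let S : ℝ × E → (E →L[ℝ] ℝ) →L[ℝ] (E →L[ℝ] ℝ) := fun q =>
    (η q).comp (T q) - ContinuousLinearMap.id ℝ _
  have hS : SmoothNear r S (t₀, 0) := (hη.clm_comp hT).sub (smoothNear_const _ _)
  -- With `Y = -T w` this is `-w - η(Y, ·)`, the part of the equation not yet satisfied. At points
  -- of `L` it annihilates `L`: it vanishes on `H` by the choice of `T`, and on `K` because `K` is
  -- orthogonal to `Y` and `w(K) = 0` by the choice of `g`.
  let β : ℝ × E → E →L[ℝ] ℝ := fun q => S q (w q)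
  have hβ : SmoothNear r β (t₀, 0) := hS.clm_apply hw
  have hβ0 : ∀ᶠ q in 𝓝 (t₀, (0 : E)), q.2 = 0 → β q = 0 ∧ ∀ u, fderiv ℝ β q (0, u) = 0 := by
    filter_upwards [hw0, hw.eventually_differentiableAt hr, hS.eventually_differentiableAt hr]
      with q h1 h2 h3 hq
    refine ⟨by simp only [β, (h1 hq).1, map_zero], fun u => ?_⟩
    have e3 : HasFDerivAt β _ q := h3.hasFDerivAt.clm_apply h2.hasFDerivAt
    rw [e3.fderiv]
    simp only [ContinuousLinearMap.comp_apply, (h1 hq).1, (h1 hq).2, map_zero, add_zero]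
  let π : ℝ × E → ℝ × E := fun q => (q.1, P q.2)
  have hπs : ContDiff ℝ r π := by fun_prop
  have hπ0 : π (t₀, 0) = (t₀, 0) := by simp [π]
  have hπ : Tendsto π (𝓝 (t₀, 0)) (𝓝 (t₀, 0)) := by
    have := hπs.continuous.tendsto (t₀, 0)
    rwa [hπ0] at this
  have hπd : ∀ q, HasFDerivAt π ((ContinuousLinearMap.fst ℝ ℝ E).prod
      (P.comp (ContinuousLinearMap.snd ℝ ℝ E))) q := fun q =>
    ((ContinuousLinearMap.fst ℝ ℝ E).prod (P.comp (ContinuousLinearMap.snd ℝ ℝ E))).hasFDerivAt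
  -- Linear in the transversal variable `x - P x`, so that at points of `L` the differential is `dg
  -- ∘ P + β ∘ (1 - P)`.
  let f : ℝ × E → ℝ := fun q => g (π q) + β (π q) (q.2 - P q.2)
  have hgπ := hg.comp_of_eq (hπs.smoothNear _) hπ0
  have hβπ := hβ.comp_of_eq (hπs.smoothNear _) hπ0
  have hQs : ContDiff ℝ r (fun q : ℝ × E => q.2 - P q.2) := by fun_prop
  have hf : SmoothNear r f (t₀, 0) := hgπ.add (hβπ.clm_apply (hQs.smoothNear _))
  have hfd : ∀ᶠ q in 𝓝 (t₀, (0 : E)), ∀ v, partialDiff f q v =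
      partialDiff g (π q) (P v) + (β (π q) (v - P v) +
        fderiv ℝ β (π q) (0, P v) (q.2 - P q.2)) := by
    filter_upwards [hπ.eventually (hg.eventually_differentiableAt hr),
      hπ.eventually (hβ.eventually_differentiableAt hr)] with q h1 h2 v
    have e1 := h1.hasFDerivAt.comp q (hπd q)
    have e2 := h2.hasFDerivAt.comp q (hπd q)
    have e3 : HasFDerivAt (fun q : ℝ × E => q.2 - P q.2) (ContinuousLinearMap.snd ℝ ℝ E -
      P.comp (ContinuousLinearMap.snd ℝ ℝ E)) q :=
      (ContinuousLinearMap.snd ℝ ℝ E - P.comp (ContinuousLinearMap.snd ℝ ℝ E)).hasFDerivAt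
    have e4 : HasFDerivAt f _ q := e1.add (e2.clm_apply e3)
    rw [partialDiff_apply, e4.fderiv]
    rfl
  refine ⟨f, hf, ?_, ?_⟩
  · filter_upwards [hfd, halt, hgK, hKH, hTs] with q h1 h2 h3 h4 h5 hq
    have hPq : P q.2 = q.2 := hPL _ hq
    have hπq : π q = q := Prod.ext rfl hPq
    set Y := -T q (w q) with hY
    have hYH : Y ∈ H := H.neg_mem (hTH q _)
    have hβq : ∀ v, β q v = -(w q v) - η q Y v := by
      intro v
      simp only [β, S, hY, sub_apply, ContinuousLinearMap.comp_apply, ContinuousLinearMap.id_apply,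
        map_neg, neg_apply]
      ring
    have hβL : ∀ v ∈ L, β q v = 0 := by
      intro v hv
      obtain ⟨hKmem, hspan⟩ := hKL q
      obtain ⟨h, hh, c, rfl⟩ := hspan v hv
      have i1 : β q h = 0 := by
        rw [hβq, hY, map_neg, neg_apply, h5 _ h hh]; ring
      have i2 : β q (K q) = 0 := by
        rw [hβq, h2 Y, h4 Y hYH]
        simp only [w, add_apply, ContinuousLinearMap.comp_apply, hPL _ hKmem, h3]
        ring
      rw [map_add, map_smul, i1, i2]; simp
    refine ⟨Y, hLH.le hYH, fun v => ?_⟩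
    have i3 := hβq v
    simp only [w, add_apply, ContinuousLinearMap.comp_apply] at i3
    rw [h1, hπq, hPq, sub_self, map_zero, add_zero, map_sub, hβL _ (hP v), i3]
    ring
  -- Where `P x = 0`, all coefficients are evaluated at `(t, 0)`. The term with the derivative of
  -- `β` is the reason for requiring that `α` and `dg` vanish there with their first space
  -- derivatives.
  · filter_upwards [hfd, hπ.eventually hg0, hπ.eventually hβ0] with q h1 h2 h3 hq
    ext v
    rw [h1, (h2 hq).1, (h3 hq).1, (h3 hq).2]
    simp

end Stratum

/-! ### Flows of time-dependent fields and invariance of subspaces -/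

section TimeDependentFlow

variable {E : Type u} [NormedAddCommGroup E] [NormedSpace ℝ E] {r : WithTop ℕ∞}

/-- The derivative of a parametrized family of curves with respect to the parameter satisfies the
variational equation. -/
theorem eventually_hasDerivAt_fderiv {W : Type*} [NormedAddCommGroup W] [NormedSpace ℝ W]
    (hr : r = ∞ ∨ r = ω) {Φ : ℝ × E → W} {G : ℝ × E → W} {q₀ : ℝ × E} (hΦ : SmoothNear r Φ q₀)
    (hG : ∀ᶠ q in 𝓝 q₀, HasDerivAt (fun s => Φ (s, q.2)) (G q) q.1) :
    ∀ᶠ q in 𝓝 q₀, ∀ u : E,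
      HasDerivAt (fun s => fderiv ℝ Φ (s, q.2) (0, u)) (fderiv ℝ G q (0, u)) q.1 := by
  have hline : ∀ q : ℝ × E, HasDerivAt (fun s : ℝ => (s, q.2)) ((1 : ℝ), (0 : E)) q.1 := fun q =>
    (hasDerivAt_id q.1).prodMk (hasDerivAt_const _ _)
  have hd : ∀ᶠ q in 𝓝 q₀, G q = fderiv ℝ Φ q (1, 0) := by
    filter_upwards [hG, hΦ.eventually_differentiableAt hr] with q h1 h2
    have h3 := h2.hasFDerivAt.comp_hasDerivAt q.1 (hline q)
    exact h1.unique h3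
  filter_upwards [hd.eventually_nhds, hΦ, (hΦ.fderiv hr).eventually_differentiableAt hr]
    with q h1 h2 h4 u
  have hsymm := (h2.isSymmSndFDerivAt (minSmoothness_le_of_infty_or_omega hr)).eq (1, 0) (0, u)
  have h7 : HasDerivAt (fun s => fderiv ℝ Φ (s, q.2)) (fderiv ℝ (fderiv ℝ Φ) q (1, 0)) q.1 :=
    h4.hasFDerivAt.comp_hasDerivAt q.1 (hline q)
  have h8 := h7.clm_apply (hasDerivAt_const q.1 ((0 : ℝ), u))
  refine h8.congr_deriv ?_
  rw [map_zero, add_zero, hsymm]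
  have e1 := (h4.hasFDerivAt.clm_apply (hasFDerivAt_const ((1 : ℝ), (0 : E)) q))
  rw [(e1.congr_of_eventuallyEq h1).fderiv]
  simp

/-- The local flow of a time-dependent vector field of class `C^r`. -/
theorem exists_time_dependent_flow [CompleteSpace E] (hr : r = ∞ ∨ r = ω) {X : ℝ × E → E} {t₀ : ℝ}
    {x₀ : E} (hX : SmoothNear r X (t₀, x₀)) :
    ∃ Φ : ℝ × E → E, SmoothNear r Φ (0, x₀) ∧
      (∀ᶠ q in 𝓝 ((0 : ℝ), x₀), HasDerivAt (fun s => Φ (s, q.2)) (X (t₀ + q.1, Φ q)) q.1) ∧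
      ∀ᶠ x in 𝓝 x₀, Φ (0, x) = x := by
  obtain ⟨φ, hφ, hflow, hφ0⟩ := exists_local_flow hr (V := ℝ × E)
    (Z := fun q => ((1 : ℝ), X q)) ((smoothNear_const 1 _).prodMk hX)
  have hins : ContDiff ℝ r (fun q : ℝ × E => (q.1, (t₀, q.2))) := by fun_prop
  have hinst : Tendsto (fun q : ℝ × E => (q.1, (t₀, q.2))) (𝓝 (0, x₀)) (𝓝 (0, (t₀, x₀))) :=
    hins.continuous.tendsto _
  have hinst' : Tendsto (fun x : E => (t₀, x)) (𝓝 x₀) (𝓝 (t₀, x₀)) := by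
    have : Continuous (fun x : E => (t₀, x)) := by fun_prop
    exact this.tendsto _
  have hflow' := hinst.eventually hflow
  have hstart := hinst'.eventually hφ0
  -- In the autonomous system on `ℝ × E` the time coordinate moves with unit speed, so its
  -- difference with `s` is constant.
  have htime : ∀ᶠ q in 𝓝 ((0 : ℝ), x₀), (φ (q.1, (t₀, q.2))).1 = t₀ + q.1 := by
    obtain ⟨ε, hε, hb⟩ := Metric.eventually_nhds_iff_ball.1 hflow'
    obtain ⟨ε', hε', hb'⟩ := Metric.eventually_nhds_iff_ball.1 hstart
    filter_upwards [Metric.ball_mem_nhds ((0 : ℝ), x₀) (lt_min hε hε')] with q hq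
    rw [← ball_prod_same] at hq
    obtain ⟨h1, h2⟩ := hq
    have hder : ∀ s ∈ Metric.ball (0 : ℝ) ε,
        HasDerivAt (fun s => (φ (s, (t₀, q.2))).1 - s) 0 s := by
      intro s hs
      have h3 := hb (s, q.2) (by
        rw [← ball_prod_same]
        exact ⟨hs, Metric.ball_subset_ball (min_le_left _ _) h2⟩)
      have h4 : HasDerivAt (fun s => (φ (s, (t₀, q.2))).1) 1 s :=
        (ContinuousLinearMap.fst ℝ ℝ E).hasFDerivAt.comp_hasDerivAt s h3
      exact (h4.sub (hasDerivAt_id s)).congr_deriv (sub_self 1)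
    have hconst := Metric.isOpen_ball.is_const_of_deriv_eq_zero (convex_ball (0 : ℝ) ε).isPreconnected
      (fun s hs => (hder s hs).differentiableAt.differentiableWithinAt)
      (fun s hs => (hder s hs).deriv) (Metric.ball_subset_ball (min_le_left _ _) h1)
      (Metric.mem_ball_self hε)
    simp only [sub_zero, hb' q.2 (Metric.ball_subset_ball (min_le_right _ _) h2)] at hconst
    linarith
  refine ⟨fun q => (φ (q.1, (t₀, q.2))).2, ?_, ?_, ?_⟩
  · exact (hφ.comp_of_eq (hins.smoothNear _) rfl).clm (ContinuousLinearMap.snd ℝ ℝ E)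
  · filter_upwards [hflow', htime] with q h1 h2
    have h3 : HasDerivAt (fun s => (φ (s, (t₀, q.2))).2) (X (φ (q.1, (t₀, q.2)))) q.1 :=
      (ContinuousLinearMap.snd ℝ ℝ E).hasFDerivAt.comp_hasDerivAt q.1 h1
    rwa [← h2]
  · filter_upwards [hstart] with x hx
    rw [hx]

/-- Grönwall's inequality forwards in time; the backward case follows by reversing time. -/
theorem eq_zero_of_norm_deriv_le {f f' : ℝ → E} {K ε : ℝ}
    (hf : ∀ s ∈ Set.Ioo (-ε) ε, HasDerivAt f (f' s) s)
    (hbound : ∀ s ∈ Set.Ioo (-ε) ε, ‖f' s‖ ≤ K * ‖f s‖) {a b : ℝ} (ha : a ∈ Set.Ioo (-ε) ε)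
    (hb : b ∈ Set.Ioo (-ε) ε) (h0 : f a = 0) : f b = 0 := by
  have key : ∀ {f f' : ℝ → E}, (∀ s ∈ Set.Ioo (-ε) ε, HasDerivAt f (f' s) s) →
      (∀ s ∈ Set.Ioo (-ε) ε, ‖f' s‖ ≤ K * ‖f s‖) → ∀ {a b : ℝ}, a ∈ Set.Ioo (-ε) ε →
      b ∈ Set.Ioo (-ε) ε → a ≤ b → f a = 0 → f b = 0 := by
    intro f f' hf hbound a b ha hb hab h0
    have hsub : ∀ s ∈ Set.Icc a b, s ∈ Set.Ioo (-ε) ε := fun s hs =>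
      ⟨ha.1.trans_le hs.1, hs.2.trans_lt hb.2⟩
    exact eq_zero_of_abs_deriv_le_mul_abs_self_of_eq_zero_right
      (fun s hs => (hf s (hsub s hs)).continuousAt.continuousWithinAt)
      (fun s hs => (hf s (hsub s (Set.Ico_subset_Icc_self hs))).hasDerivWithinAt) h0
      (fun s hs => hbound s (hsub s (Set.Ico_subset_Icc_self hs))) b (Set.right_mem_Icc.2 hab)
  rcases le_total a b with hab | hab
  · exact key hf hbound ha hb hab h0
  · have hneg : ∀ s ∈ Set.Ioo (-ε) ε, -s ∈ Set.Ioo (-ε) ε := fun s hs =>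
      ⟨by linarith [hs.2], by linarith [hs.1]⟩
    have := key (f := fun s => f (-s)) (f' := fun s => -f' (-s)) (a := -a) (b := -b)
      (fun s hs => by
        have h1 := (hf (-s) (hneg s hs)).scomp s (hasDerivAt_neg s)
        rw [neg_one_smul] at h1
        exact h1)
      (fun s hs => by rw [norm_neg]; exact hbound _ (hneg s hs)) (hneg a ha) (hneg b hb)
      (neg_le_neg hab) (by simpa using h0)
    simpa using this

/-- The trajectories of a time-dependent vector field which is tangent to a subspace `L` do not
enter or leave `L`. -/
theorem exists_nhds_trajectory_mem_iff (hr : r = ∞ ∨ r = ω) {X : ℝ × E → E} {t₀ : ℝ}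
    (hX : SmoothNear r X (t₀, 0)) {L : Submodule ℝ E} {P : E →L[ℝ] E} (hP : ∀ v, P v ∈ L)
    (hPL : ∀ v ∈ L, P v = v) (htan : ∀ᶠ q in 𝓝 (t₀, (0 : E)), q.2 ∈ L → X q ∈ L) :
    ∃ O ∈ 𝓝 (t₀, (0 : E)), ∀ (ε : ℝ) (y : ℝ → E), (∀ s ∈ Set.Ioo (-ε) ε, (t₀ + s, y s) ∈ O) →
      (∀ s ∈ Set.Ioo (-ε) ε, HasDerivAt y (X (t₀ + s, y s)) s) →
      ∀ a ∈ Set.Ioo (-ε) ε, ∀ b ∈ Set.Ioo (-ε) ε, y a ∈ L → y b ∈ L := by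
  obtain ⟨K, O₁, hO₁, hlip⟩ :=
    (hX.contDiffAt.of_le (one_le_of_infty_or_omega hr)).exists_lipschitzOnWith
  have hproj : Tendsto (fun q : ℝ × E => (q.1, P q.2)) (𝓝 (t₀, 0)) (𝓝 (t₀, 0)) := by
    have : Continuous (fun q : ℝ × E => (q.1, P q.2)) := by fun_prop
    simpa using this.tendsto (t₀, 0)
  have hO : ∀ᶠ q in 𝓝 (t₀, (0 : E)), q ∈ O₁ ∧ (q.1, P q.2) ∈ O₁ ∧ X (q.1, P q.2) ∈ L := by
    filter_upwards [hO₁, hproj.eventually hO₁, hproj.eventually htan] with q h1 h2 h3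
    exact ⟨h1, h2, h3 (hP _)⟩
  refine ⟨_, hO, fun ε y hy hy' a ha b hb hya => ?_⟩
  let N : E →L[ℝ] E := ContinuousLinearMap.id ℝ E - P
  have hN : ∀ v, N v = v - P v := fun v => rfl
  have hNL : ∀ v, N v = 0 ↔ v ∈ L := fun v =>
    ⟨fun h => by rw [hN, sub_eq_zero] at h; rw [h]; exact hP v,
      fun h => by rw [hN, hPL v h, sub_self]⟩
  refine (hNL _).1 (eq_zero_of_norm_deriv_le (f := fun s => N (y s))
    (f' := fun s => N (X (t₀ + s, y s))) (K := ‖N‖ * K) (ε := ε)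
    (fun s hs => N.hasFDerivAt.comp_hasDerivAt s (hy' s hs)) (fun s hs => ?_) ha hb
    ((hNL _).2 hya))
  obtain ⟨h1, h2, h3⟩ := hy s hs
  -- `X` at the projected point lies in `L = ker N`, so it can be subtracted; the Lipschitz bound
  -- then controls the derivative of `N y` by `‖y - P y‖ = ‖N y‖`.
  have h4 : N (X (t₀ + s, y s)) = N (X (t₀ + s, y s) - X (t₀ + s, P (y s))) := by
    rw [map_sub, (hNL _).2 h3, sub_zero]
  rw [h4, mul_assoc]
  refine (N.le_opNorm _).trans (mul_le_mul_of_nonneg_left ?_ (norm_nonneg _))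
  have h5 := hlip.dist_le_mul _ h1 _ h2
  rw [dist_eq_norm, Prod.dist_eq, dist_self, max_eq_right dist_nonneg, dist_eq_norm] at h5
  exact h5

end TimeDependentFlow

/-! ### The homotopy equation and its tangent vector field -/

section Moser

theorem tendsto_snd_nhds_zero {E : Type*} [NormedAddCommGroup E] (t₀ : ℝ) :
    Tendsto (fun q : ℝ × E => q.2) (𝓝 (t₀, 0)) (𝓝 0) :=
  continuous_snd.tendsto (t₀, (0 : E))

variable {E : Type u} [NormedAddCommGroup E] [NormedSpace ℝ E] {r : WithTop ℕ∞}

/-- The germ at `0` of a closed `2`-form of class `C^r`, in terms of bilinear maps. -/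
structure IsClosedGerm (r : WithTop ℕ∞) (η : E → E →L[ℝ] E →L[ℝ] ℝ) : Prop where
  smooth : SmoothNear r η 0
  alternating : ∀ᶠ x in 𝓝 0, ∀ u v, η x u v = -η x v u
  closed : ∀ᶠ x in 𝓝 0, ∀ u v w,
    fderiv ℝ η x u v w + fderiv ℝ η x v w u + fderiv ℝ η x w u v = 0

theorem IsClosedGerm.sub (hr : r = ∞ ∨ r = ω) {σ τ : E → E →L[ℝ] E →L[ℝ] ℝ}
    (hσ : IsClosedGerm r σ) (hτ : IsClosedGerm r τ) : IsClosedGerm r (fun x => σ x - τ x) := by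
  refine ⟨hσ.smooth.sub hτ.smooth, ?_, ?_⟩
  · filter_upwards [hσ.alternating, hτ.alternating] with x h1 h2 u v
    rw [sub_apply, sub_apply, sub_apply, sub_apply, h1, h2]
    ring
  · filter_upwards [hσ.closed, hτ.closed, hσ.smooth.eventually_differentiableAt hr,
      hτ.smooth.eventually_differentiableAt hr] with x h1 h2 h3 h4 u v w
    rw [fderiv_fun_sub h3 h4]
    simp only [sub_apply]
    linear_combination h1 u v w - h2 u v w

/-- The linear path of forms `σ + t δ`. -/
noncomputable def formPath (σ δ : E → E →L[ℝ] E →L[ℝ] ℝ) (q : ℝ × E) : E →L[ℝ] E →L[ℝ] ℝ :=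
  σ q.2 + q.1 • δ q.2

theorem formPath_apply (σ δ : E → E →L[ℝ] E →L[ℝ] ℝ) (q : ℝ × E) (u v : E) :
    formPath σ δ q u v = σ q.2 u v + q.1 * δ q.2 u v := rfl

variable {σ δ : E → E →L[ℝ] E →L[ℝ] ℝ}

theorem smoothNear_formPath (hσ : SmoothNear r σ 0) (hδ : SmoothNear r δ 0) (t₀ : ℝ) :
    SmoothNear r (formPath σ δ) (t₀, 0) := by
  have hsnd : SmoothNear r (fun q : ℝ × E => q.2) (t₀, 0) := contDiff_snd.smoothNear _
  have hfst : SmoothNear r (fun q : ℝ × E => q.1) (t₀, 0) := contDiff_fst.smoothNear _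
  exact (hσ.comp_of_eq hsnd rfl).add (hfst.smul (hδ.comp_of_eq hsnd rfl))

theorem fderiv_formPath {q : ℝ × E} (hσ : DifferentiableAt ℝ σ q.2) (hδ : DifferentiableAt ℝ δ q.2)
    (a : ℝ) (u v w : E) : fderiv ℝ (formPath σ δ) q (a, u) v w =
      fderiv ℝ σ q.2 u v w + q.1 * fderiv ℝ δ q.2 u v w + a * δ q.2 v w := by
  have e1 := hσ.hasFDerivAt.comp q hasFDerivAt_snd
  have e2 := hδ.hasFDerivAt.comp q hasFDerivAt_snd
  have e3 : HasFDerivAt (fun q : ℝ × E => q.1) (ContinuousLinearMap.fst ℝ ℝ E) q := hasFDerivAt_fst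
  have e4 : HasFDerivAt (formPath σ δ) _ q := e1.add (e3.smul e2)
  rw [e4.fderiv]
  simp only [add_apply, smul_apply, ContinuousLinearMap.comp_apply,
    ContinuousLinearMap.smulRight_apply, ContinuousLinearMap.coe_fst', ContinuousLinearMap.coe_snd',
    smul_eq_mul]
  ring

theorem eventually_formPath_alternating (hσ : ∀ᶠ x in 𝓝 0, ∀ u v, σ x u v = -σ x v u)
    (hδ : ∀ᶠ x in 𝓝 0, ∀ u v, δ x u v = -δ x v u) (t₀ : ℝ) :
    ∀ᶠ q in 𝓝 (t₀, (0 : E)), ∀ u v, formPath σ δ q u v = -formPath σ δ q v u := by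
  filter_upwards [(tendsto_snd_nhds_zero t₀).eventually hσ,
    (tendsto_snd_nhds_zero t₀).eventually hδ] with q h1 h2 u v
  rw [formPath_apply, formPath_apply, h1, h2]
  ring

/-- A pair of complementary strata: subspaces with projections which vanish on each other, on which
the `2`-form `η` has maximal rank. -/
structure IsStratumPair (η : E →L[ℝ] E →L[ℝ] ℝ) (L : Fin 2 → Submodule ℝ E)
    (P : Fin 2 → E →L[ℝ] E) : Prop where
  mem : ∀ i v, P i v ∈ L i
  eq_self : ∀ i, ∀ v ∈ L i, P i v = v
  eq_zero : ∀ i j, i ≠ j → ∀ v ∈ L j, P i v = 0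
  splitting : ∀ i, ∃ H, IsMaximalRankSplitting η (L i) H

/-- The vector field of the homotopy method: it transports `σ + t δ` along itself and is tangent to
both strata. -/
theorem exists_moser_field [FiniteDimensional ℝ E] (hr : r = ∞ ∨ r = ω) (hσ : IsClosedGerm r σ)
    (hδ : IsClosedGerm r δ) (hδ0 : δ 0 = 0) (hnd : ∀ u, (∀ v, σ 0 u v = 0) → u = 0)
    {L : Fin 2 → Submodule ℝ E} {P : Fin 2 → E →L[ℝ] E} (hLP : IsStratumPair (σ 0) L P) (t₀ : ℝ) :
    ∃ X : ℝ × E → E, SmoothNear r X (t₀, 0) ∧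
      (∀ i, ∀ᶠ q in 𝓝 (t₀, (0 : E)), q.2 ∈ L i → X q ∈ L i) ∧
      ∀ᶠ q in 𝓝 (t₀, (0 : E)), ∀ u v, fderiv ℝ (formPath σ δ) q (1, X q) u v +
        formPath σ δ q (fderiv ℝ X q (0, u)) v + formPath σ δ q u (fderiv ℝ X q (0, v)) = 0 := by
  obtain ⟨α, hα, hα0, hα1, hdα⟩ := exists_primitive_of_closed hr hδ.smooth hδ.alternating hδ.closed
  have hη := smoothNear_formPath hσ.smooth hδ.smooth t₀
  have halt := eventually_formPath_alternating hσ.alternating hδ.alternating t₀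
  have hη0 : ∀ q : ℝ × E, q.2 = 0 → formPath σ δ q = σ 0 := fun q hq => by
    rw [formPath, hq, hδ0, smul_zero, add_zero]
  have hcor : ∀ i, ∃ f : ℝ × E → ℝ, SmoothNear r f (t₀, 0) ∧
      (∀ᶠ q in 𝓝 (t₀, (0 : E)), q.2 ∈ L i →
        ∃ Y ∈ L i, ∀ v, α q.2 v + partialDiff f q v = -formPath σ δ q Y v) ∧
      ∀ᶠ q in 𝓝 (t₀, (0 : E)), P i q.2 = 0 → partialDiff f q = 0 := by
    intro i
    obtain ⟨H, hH⟩ := hLP.splitting i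
    refine exists_stratum_correction hr hη halt
      (Eventually.of_forall fun q hq => by rw [hη0 q hq, hη0 _ rfl]) (H := H) ?_ (hLP.mem i)
      (hLP.eq_self i) hα hα0 (hα1 hδ0)
    rwa [hη0 _ rfl]
  choose f hf hfL hfP using hcor
  obtain ⟨T, hT, -, -, hTs, hTs'⟩ := exists_solution_operator hη ⊤ (by
    intro u _ hu
    rw [hη0 _ rfl] at hu
    exact hnd u fun v => hu v trivial)
  have hsnd : SmoothNear r (fun q : ℝ × E => q.2) (t₀, 0) := contDiff_snd.smoothNear _
  have hα2 : SmoothNear r (fun q : ℝ × E => α q.2) (t₀, 0) := hα.comp_of_eq hsnd rfl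
  let F : ℝ × E → ℝ := fun q => f 0 q + f 1 q
  have hF : SmoothNear r F (t₀, 0) := (hf 0).add (hf 1)
  have hFd : ∀ᶠ q in 𝓝 (t₀, (0 : E)), partialDiff F q = partialDiff (f 0) q + partialDiff (f 1) q := by
    filter_upwards [(hf 0).eventually_differentiableAt hr, (hf 1).eventually_differentiableAt hr]
      with q h0 h1
    ext v
    simp only [partialDiff_apply, add_apply, F, fderiv_fun_add h0 h1]
  let γ : ℝ × E → E →L[ℝ] ℝ := fun q => α q.2 + partialDiff F q
  have hpF := hF.partialDiff hr
  have hγ : SmoothNear r γ (t₀, 0) := hα2.add hpF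
  let X : ℝ × E → E := fun q => -T q (γ q)
  have hX : SmoothNear r X (t₀, 0) := (hT.clm_apply hγ).neg
  have hXη : ∀ᶠ q in 𝓝 (t₀, (0 : E)), formPath σ δ q (X q) = -γ q := by
    filter_upwards [hTs] with q hq
    ext v
    simp only [X, map_neg, neg_apply, hq (γ q) v trivial]
  -- On `L i` the projection `P j` vanishes, so `f j` contributes nothing and the field is the `Y`
  -- in `L i` provided by the correction `f i`.
  have htan : ∀ i j, i ≠ j → (∀ q, partialDiff (f 0) q + partialDiff (f 1) q =
      partialDiff (f i) q + partialDiff (f j) q) →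
      ∀ᶠ q in 𝓝 (t₀, (0 : E)), q.2 ∈ L i → X q ∈ L i := by
    intro i j hij hsum
    filter_upwards [hfL i, hfP j, hFd, hTs'] with q h1 h2 h3 h4 hq
    obtain ⟨Y, hY, hYv⟩ := h1 hq
    have h5 : γ q = -formPath σ δ q Y := by
      ext v
      simp only [γ]
      rw [h3, hsum, h2 (hLP.eq_zero j i hij.symm _ hq), add_zero, add_apply, hYv]
      rfl
    have h6 : X q = Y := by
      simp only [X]
      rw [h5, map_neg, neg_neg, h4 Y trivial]
    rwa [h6]
  refine ⟨X, hX, ?_, ?_⟩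
  · intro i
    fin_cases i
    · exact htan 0 1 (by decide) fun q => rfl
    · exact htan 1 0 (by decide) fun q => add_comm _ _
  · have hsn := tendsto_snd_nhds_zero (E := E) t₀
    filter_upwards [hXη.eventually_nhds, hη.eventually_differentiableAt hr,
      hX.eventually_differentiableAt hr, hpF.eventually_differentiableAt hr, hF,
      (hF.fderiv hr).eventually_differentiableAt hr,
      hsn.eventually (hα.eventually_differentiableAt hr), hsn.eventually hdα,
      hsn.eventually hσ.closed, hsn.eventually hδ.closed,
      hsn.eventually (hσ.smooth.eventually_differentiableAt hr),
      hsn.eventually (hδ.smooth.eventually_differentiableAt hr),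
      eventually_fderiv_alternating hr hη halt, halt]
      with q h1 h2 h3 h4 h5 h6 h7 h8 h9 h10 h11 h12 h13 h14 u v
    have hα' : HasFDerivAt (fun q : ℝ × E => α q.2)
        ((fderiv ℝ α q.2).comp (ContinuousLinearMap.snd ℝ ℝ E)) q :=
      h7.hasFDerivAt.comp q hasFDerivAt_snd
    have hγ' : HasFDerivAt γ _ q := hα'.add h4.hasFDerivAt
    have hD : ∀ w v, fderiv ℝ (partialDiff F) q w v = fderiv ℝ (fderiv ℝ F) q w (0, v) := by
      intro w v
      have e1 : fderiv ℝ (partialDiff F) q =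
          ((ContinuousLinearMap.compL ℝ E (ℝ × E) ℝ).flip (ContinuousLinearMap.inr ℝ ℝ E)).comp
            (fderiv ℝ (fderiv ℝ F) q) :=
        (((ContinuousLinearMap.compL ℝ E (ℝ × E) ℝ).flip
          (ContinuousLinearMap.inr ℝ ℝ E)).hasFDerivAt.comp q h6.hasFDerivAt).fderiv
      rw [e1]; rfl
    have hsymm : fderiv ℝ (partialDiff F) q (0, u) v = fderiv ℝ (partialDiff F) q (0, v) u := by
      rw [hD, hD]
      exact (h5.isSymmSndFDerivAt (minSmoothness_le_of_infty_or_omega hr)).eq _ _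
    -- The space derivative of `η(X, ·) = -(α + dF)`. Its antisymmetrization loses the Hessian of
    -- `F` and leaves `-dα = -δ`.
    have hdiff : ∀ u v, fderiv ℝ (formPath σ δ) q (0, u) (X q) v +
        formPath σ δ q (fderiv ℝ X q (0, u)) v =
        -(fderiv ℝ α q.2 u v + fderiv ℝ (partialDiff F) q (0, u) v) := by
      intro u v
      have e1 := h2.hasFDerivAt.clm_apply h3.hasFDerivAt
      have e2 := e1.unique (hγ'.neg.congr_of_eventuallyEq h1)
      have e3 := congrArg (fun A : ℝ × E →L[ℝ] E →L[ℝ] ℝ => A (0, u) v) e2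
      simp only [add_apply, neg_apply, ContinuousLinearMap.comp_apply,
        ContinuousLinearMap.flip_apply, ContinuousLinearMap.coe_snd'] at e3
      linear_combination e3
    have hcl : fderiv ℝ (formPath σ δ) q (0, X q) u v + fderiv ℝ (formPath σ δ) q (0, u) v (X q) +
        fderiv ℝ (formPath σ δ) q (0, v) (X q) u = 0 := by
      simp only [fderiv_formPath h11 h12]
      linear_combination h9 (X q) u v + q.1 * h10 (X q) u v
    have hone : fderiv ℝ (formPath σ δ) q (1, X q) u v =
        fderiv ℝ (formPath σ δ) q (0, X q) u v + δ q.2 u v := by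
      simp only [fderiv_formPath h11 h12]
      ring
    rw [hone]
    -- Cartan's formula written out: closedness turns the derivative of `η` along `X` into the
    -- antisymmetrized derivative of `η(X, ·)`, which cancels `∂_t η = δ`.
    linear_combination hdiff u v - hdiff v u + hcl - h13 (0, u) v (X q) - h8 u v - hsymm +
      h14 u (fderiv ℝ X q (0, v))

end Moser

/-! ### Equivalence of germs of forms together with strata -/

section Equivalence

variable {E : Type*} [NormedAddCommGroup E] [NormedSpace ℝ E] {r : WithTop ℕ∞}

/-- The tuples `(E, B, N)₀` and `(E, B', N')₀` are diffeomorphic, for forms given by bilinear maps. -/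
def FormEquiv (r : WithTop ℕ∞) (B : E → E →L[ℝ] E →L[ℝ] ℝ) (N : Set E)
    (B' : E → E →L[ℝ] E →L[ℝ] ℝ) (N' : Set E) : Prop :=
  ∃ Ψ : OpenPartialHomeomorph E E, IsLocalDiffeo r Ψ ∧ (0 : E) ∈ Ψ.source ∧ Ψ 0 = 0 ∧
    (∀ᶠ x in 𝓝 0, ∀ u v, B' (Ψ x) (fderiv ℝ Ψ x u) (fderiv ℝ Ψ x v) = B x u v) ∧
    ∀ᶠ x in 𝓝 0, x ∈ N ↔ Ψ x ∈ N'

theorem tendsto_of_map_zero {E : Type*} [NormedAddCommGroup E] {Ψ : OpenPartialHomeomorph E E}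
    (h0 : (0 : E) ∈ Ψ.source)
    (hΨ0 : Ψ 0 = 0) : Tendsto Ψ (𝓝 0) (𝓝 0) := by
  have := (Ψ.continuousAt h0).tendsto
  rwa [hΨ0] at this

theorem FormEquiv.refl (B : E → E →L[ℝ] E →L[ℝ] ℝ) (N : Set E) : FormEquiv r B N B N := by
  refine ⟨OpenPartialHomeomorph.refl E, ⟨contDiff_id.contDiffOn, contDiff_id.contDiffOn⟩,
    trivial, rfl, Eventually.of_forall fun x u v => ?_, Eventually.of_forall fun x => Iff.rfl⟩
  simp

theorem FormEquiv.symm (hr : r = ∞ ∨ r = ω) {B B' : E → E →L[ℝ] E →L[ℝ] ℝ} {N N' : Set E}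
    (h : FormEquiv r B N B' N') : FormEquiv r B' N' B N := by
  obtain ⟨Ψ, hΨ, h0, hΨ0, hB, hN⟩ := h
  have h0t : (0 : E) ∈ Ψ.target := by rw [← hΨ0]; exact Ψ.map_source h0
  have hΨ0' : Ψ.symm 0 = 0 := by
    have := Ψ.left_inv h0
    rwa [hΨ0] at this
  have hlim : Tendsto Ψ.symm (𝓝 0) (𝓝 0) := tendsto_of_map_zero (Ψ := Ψ.symm) h0t hΨ0'
  refine ⟨Ψ.symm, hΨ.symm, h0t, hΨ0', ?_, ?_⟩
  · filter_upwards [hlim.eventually hB, Ψ.open_target.mem_nhds h0t,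
      hlim.eventually ((hΨ.smoothNear h0).eventually_differentiableAt hr),
      (hΨ.symm.smoothNear (a := (0 : E)) h0t).eventually_differentiableAt hr] with y h1 h2 h3 h4 u v
    have e1 : HasFDerivAt (fun y => Ψ (Ψ.symm y))
        ((fderiv ℝ Ψ (Ψ.symm y)).comp (fderiv ℝ Ψ.symm y)) y :=
      h3.hasFDerivAt.comp y h4.hasFDerivAt
    have e2 : HasFDerivAt (fun y => Ψ (Ψ.symm y)) (ContinuousLinearMap.id ℝ E) y := by
      refine (hasFDerivAt_id y).congr_of_eventuallyEq ?_
      filter_upwards [Ψ.open_target.mem_nhds h2] with z hz using Ψ.right_inv hz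
    have e3 : ∀ w, fderiv ℝ Ψ (Ψ.symm y) (fderiv ℝ Ψ.symm y w) = w := fun w =>
      congrArg (fun A : E →L[ℝ] E => A w) (e1.unique e2)
    rw [← h1, e3, e3, Ψ.right_inv h2]
  · filter_upwards [hlim.eventually hN, Ψ.open_target.mem_nhds h0t] with y h1 h2
    rw [h1, Ψ.right_inv h2]

theorem FormEquiv.trans (hr : r = ∞ ∨ r = ω) {B B' B'' : E → E →L[ℝ] E →L[ℝ] ℝ} {N N' N'' : Set E}
    (h : FormEquiv r B N B' N') (h' : FormEquiv r B' N' B'' N'') : FormEquiv r B N B'' N'' := by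
  obtain ⟨Ψ, hΨ, h0, hΨ0, hB, hN⟩ := h
  obtain ⟨Θ, hΘ, k0, hΘ0, hB', hN'⟩ := h'
  have hlim := tendsto_of_map_zero h0 hΨ0
  refine ⟨Ψ.trans Θ, hΨ.trans hΘ, ?_, ?_, ?_, ?_⟩
  · rw [OpenPartialHomeomorph.trans_source]
    exact ⟨h0, by rw [Set.mem_preimage, hΨ0]; exact k0⟩
  · rw [OpenPartialHomeomorph.coe_trans, Function.comp_apply, hΨ0, hΘ0]
  · filter_upwards [hB, hlim.eventually hB',
      (hΨ.smoothNear h0).eventually_differentiableAt hr,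
      hlim.eventually ((hΘ.smoothNear k0).eventually_differentiableAt hr)] with x h1 h2 h3 h4 u v
    rw [OpenPartialHomeomorph.coe_trans, fderiv_comp x h4 h3]
    simp only [ContinuousLinearMap.comp_apply, Function.comp_apply, h2, h1]
  · filter_upwards [hN, hlim.eventually hN'] with x h1 h2
    rw [h1, h2]
    rfl

end Equivalence

/-! ### From short times to all times -/

section ShortTime

variable {E : Type u} [NormedAddCommGroup E] [NormedSpace ℝ E] {r : WithTop ℕ∞}
  {σ δ : E → E →L[ℝ] E →L[ℝ] ℝ}

/-- A vector field satisfying the homotopy equation transports the path of forms. -/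
theorem hasDerivAt_formPath_transport {X : ℝ × E → E} {t₀ : ℝ} {y U V : ℝ → E} {s : ℝ}
    (hη : DifferentiableAt ℝ (formPath σ δ) (t₀ + s, y s))
    (hy : HasDerivAt y (X (t₀ + s, y s)) s)
    (hU : HasDerivAt U (fderiv ℝ X (t₀ + s, y s) (0, U s)) s)
    (hV : HasDerivAt V (fderiv ℝ X (t₀ + s, y s) (0, V s)) s)
    (hX : ∀ u v, fderiv ℝ (formPath σ δ) (t₀ + s, y s) (1, X (t₀ + s, y s)) u v +
        formPath σ δ (t₀ + s, y s) (fderiv ℝ X (t₀ + s, y s) (0, u)) v +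
        formPath σ δ (t₀ + s, y s) u (fderiv ℝ X (t₀ + s, y s) (0, v)) = 0) :
    HasDerivAt (fun s => formPath σ δ (t₀ + s, y s) (U s) (V s)) 0 s := by
  have h1 : HasDerivAt (fun s => (t₀ + s, y s)) ((1 : ℝ), X (t₀ + s, y s)) s :=
    ((hasDerivAt_id s).const_add t₀).prodMk hy
  have h2 : HasDerivAt (fun s => formPath σ δ (t₀ + s, y s))
      (fderiv ℝ (formPath σ δ) (t₀ + s, y s) (1, X (t₀ + s, y s))) s := by
    have h3 := hη.hasFDerivAt.comp_hasDerivAt s h1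
    exact h3
  refine ((h2.clm_apply hU).clm_apply hV).congr_deriv ?_
  rw [add_apply]
  exact hX (U s) (V s)

/-- The time-`s` flow map of the Moser field started at time `t₀` is the required diffeomorphism: it
transports the forms by the homotopy equation and preserves each stratum by tangency. -/
theorem exists_short_time_formEquiv [FiniteDimensional ℝ E] (hr : r = ∞ ∨ r = ω)
    (hσ : IsClosedGerm r σ) (hδ : IsClosedGerm r δ) (hδ0 : δ 0 = 0)
    (hnd : ∀ u, (∀ v, σ 0 u v = 0) → u = 0)
    {L : Fin 2 → Submodule ℝ E} {P : Fin 2 → E →L[ℝ] E} (hLP : IsStratumPair (σ 0) L P) (t₀ : ℝ) :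
    ∀ᶠ t in 𝓝 t₀, FormEquiv r (fun x => σ x + t₀ • δ x) (L 0 ∪ L 1) (fun x => σ x + t • δ x)
      (L 0 ∪ L 1) := by
  obtain ⟨X, hX, htan, hmoser⟩ := exists_moser_field hr hσ hδ hδ0 hnd hLP t₀
  obtain ⟨Φ, hΦ, hflow, hΦ0⟩ := exists_time_dependent_flow hr hX
  have hη := smoothNear_formPath hσ.smooth hδ.smooth t₀
  choose O hO hinv using fun i => exists_nhds_trajectory_mem_iff hr hX (hLP.mem i)
    (hLP.eq_self i) (htan i)
  have hΦ00 : Φ (0, 0) = 0 := hΦ0.self_of_nhds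
  have hlim : Tendsto (fun q : ℝ × E => (t₀ + q.1, Φ q)) (𝓝 (0, 0)) (𝓝 (t₀, 0)) := by
    have h1 : ContinuousAt (fun q : ℝ × E => (t₀ + q.1, Φ q)) (0, 0) :=
      (by fun_prop : ContinuousAt (fun q : ℝ × E => t₀ + q.1) (0, 0)).prodMk hΦ.continuousAt
    have h2 := h1.tendsto
    simpa [hΦ00] using h2
  have hvar : ∀ᶠ q in 𝓝 ((0 : ℝ), (0 : E)), ∀ u, HasDerivAt (fun s => fderiv ℝ Φ (s, q.2) (0, u))
      (fderiv ℝ X (t₀ + q.1, Φ q) (0, fderiv ℝ Φ q (0, u))) q.1 := by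
    filter_upwards [eventually_hasDerivAt_fderiv hr hΦ hflow,
      hlim.eventually (hX.eventually_differentiableAt hr), hΦ.eventually_differentiableAt hr]
      with q h1 h2 h3 u
    refine (h1 u).congr_deriv ?_
    have e1 : HasFDerivAt (fun q : ℝ × E => t₀ + q.1) (ContinuousLinearMap.fst ℝ ℝ E) q :=
      hasFDerivAt_fst.const_add t₀
    have e2 : HasFDerivAt (fun q : ℝ × E => X (t₀ + q.1, Φ q)) _ q :=
      h2.hasFDerivAt.comp q (e1.prodMk h3.hasFDerivAt)
    rw [e2.fderiv]
    rfl
  have hinit : ∀ᶠ x in 𝓝 (0 : E), ∀ u, fderiv ℝ Φ (0, x) (0, u) = u := by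
    have hc : Tendsto (fun x : E => ((0 : ℝ), x)) (𝓝 0) (𝓝 (0, 0)) := by
      have : Continuous (fun x : E => ((0 : ℝ), x)) := by fun_prop
      exact this.tendsto 0
    filter_upwards [hΦ0.eventually_nhds, hc.eventually (hΦ.eventually_differentiableAt hr)]
      with x h1 h2 u
    have e1 : HasFDerivAt (fun x : E => Φ (0, x))
        ((fderiv ℝ Φ (0, x)).comp (ContinuousLinearMap.inr ℝ ℝ E)) x :=
      h2.hasFDerivAt.comp x (hasFDerivAt_prodMk_right (0 : ℝ) x)
    have e2 := e1.unique ((hasFDerivAt_id x).congr_of_eventuallyEq h1)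
    exact congrArg (fun A : E →L[ℝ] E => A u) e2
  obtain ⟨ε, hε, hbox⟩ := Metric.eventually_nhds_iff_ball.1 (hflow.and (hvar.and
    ((hlim.eventually (hO 0)).and ((hlim.eventually (hO 1)).and ((hlim.eventually hmoser).and
      ((hlim.eventually (hη.eventually_differentiableAt hr)).and hΦ))))))
  obtain ⟨ε', hε', hbox'⟩ := Metric.eventually_nhds_iff_ball.1 (hΦ0.and hinit)
  set ρ := min ε ε' with hρ
  have hρ0 : 0 < ρ := lt_min hε hε'
  have hin : ∀ s ∈ Set.Ioo (-ρ) ρ, ∀ x ∈ Metric.ball (0 : E) ρ,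
      (s, x) ∈ Metric.ball ((0 : ℝ), (0 : E)) ε := by
    intro s hs x hx
    rw [← ball_prod_same]
    refine ⟨?_, Metric.ball_subset_ball (min_le_left _ _) hx⟩
    rw [Metric.mem_ball, Real.dist_eq, sub_zero, abs_lt]
    exact ⟨by linarith [hs.1, min_le_left ε ε'], by linarith [hs.2, min_le_left ε ε']⟩
  have h00 : (0 : ℝ) ∈ Set.Ioo (-ρ) ρ := ⟨by linarith, hρ0⟩
  have hx0 : ∀ x ∈ Metric.ball (0 : E) ρ, Φ (0, x) = x ∧ ∀ u, fderiv ℝ Φ (0, x) (0, u) = u :=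
    fun x hx => hbox' x (Metric.ball_subset_ball (min_le_right _ _) hx)
  have htransport : ∀ s ∈ Set.Ioo (-ρ) ρ, ∀ x ∈ Metric.ball (0 : E) ρ, ∀ u v,
      formPath σ δ (t₀ + s, Φ (s, x)) (fderiv ℝ Φ (s, x) (0, u)) (fderiv ℝ Φ (s, x) (0, v)) =
        formPath σ δ (t₀, x) u v := by
    intro s hs x hx u v
    have hder : ∀ s ∈ Set.Ioo (-ρ) ρ, HasDerivAt (fun s => formPath σ δ (t₀ + s, Φ (s, x))
        (fderiv ℝ Φ (s, x) (0, u)) (fderiv ℝ Φ (s, x) (0, v))) 0 s := by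
      intro s hs
      obtain ⟨h1, h2, -, -, h3, h4, -⟩ := hbox _ (hin s hs x hx)
      exact hasDerivAt_formPath_transport (y := fun s => Φ (s, x))
        (U := fun s => fderiv ℝ Φ (s, x) (0, u)) (V := fun s => fderiv ℝ Φ (s, x) (0, v))
        h4 h1 (h2 u) (h2 v) h3
    have hconst := isOpen_Ioo.is_const_of_deriv_eq_zero isPreconnected_Ioo
      (fun s hs => (hder s hs).differentiableAt.differentiableWithinAt)
      (fun s hs => (hder s hs).deriv) hs h00
    rw [hconst, add_zero, (hx0 x hx).1, (hx0 x hx).2, (hx0 x hx).2]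
  have hmem : ∀ i, ∀ s ∈ Set.Ioo (-ρ) ρ, ∀ x ∈ Metric.ball (0 : E) ρ,
      (x ∈ L i ↔ Φ (s, x) ∈ L i) := by
    intro i s hs x hx
    have hOi : ∀ s ∈ Set.Ioo (-ρ) ρ, (t₀ + s, Φ (s, x)) ∈ O i := by
      intro s hs
      obtain ⟨-, -, h1, h2, -⟩ := hbox _ (hin s hs x hx)
      fin_cases i
      · exact h1
      · exact h2
    have key := hinv i ρ (fun s => Φ (s, x)) hOi (fun s hs => (hbox _ (hin s hs x hx)).1)
    constructor
    · intro h
      exact key 0 h00 s hs (by rwa [(hx0 x hx).1])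
    · intro h
      have := key s hs 0 h00 h
      rwa [(hx0 x hx).1] at this
  have h0b : (0 : E) ∈ Metric.ball (0 : E) ρ := Metric.mem_ball_self hρ0
  have hshort : ∀ s ∈ Set.Ioo (-ρ) ρ, FormEquiv r (fun x => σ x + t₀ • δ x) (L 0 ∪ L 1)
      (fun x => σ x + (t₀ + s) • δ x) (L 0 ∪ L 1) := by
    intro s hs
    let ψ : E → E := fun x => Φ (s, x)
    have hψs : ∀ x ∈ Metric.ball (0 : E) ρ, ContDiffAt ℝ r ψ x := fun x hx =>
      (hbox _ (hin s hs x hx)).2.2.2.2.2.2.comp x (contDiff_prodMk_right s).contDiffAt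
    have hψ : SmoothNear r ψ 0 := by
      filter_upwards [Metric.ball_mem_nhds (0 : E) hρ0] with x hx using hψs x hx
    have hψd : ∀ x ∈ Metric.ball (0 : E) ρ, HasFDerivAt ψ
        ((fderiv ℝ Φ (s, x)).comp (ContinuousLinearMap.inr ℝ ℝ E)) x := fun x hx =>
      ((hbox _ (hin s hs x hx)).2.2.2.2.2.2.differentiableAt
        (ne_zero_of_infty_or_omega hr)).hasFDerivAt.comp x (hasFDerivAt_prodMk_right s x)
    -- The origin is fixed because it lies in both strata, these are preserved, and they meet only
    -- at `0`.
    have hψ0 : ψ 0 = 0 := by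
      have h1 : ψ 0 ∈ L 0 := (hmem 0 s hs 0 h0b).1 (L 0).zero_mem
      have h2 : ψ 0 ∈ L 1 := (hmem 1 s hs 0 h0b).1 (L 1).zero_mem
      rw [← hLP.eq_self 0 _ h1]
      exact hLP.eq_zero 0 1 (by decide) _ h2
    let A : E →L[ℝ] E := (fderiv ℝ Φ (s, 0)).comp (ContinuousLinearMap.inr ℝ ℝ E)
    -- A kernel vector of the derivative would be a kernel vector of the pulled back form at `0`,
    -- which is the nondegenerate `σ 0`.
    have hAinj : Function.Injective (A : E →ₗ[ℝ] E) := by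
      rw [← LinearMap.ker_eq_bot, LinearMap.ker_eq_bot']
      intro u hu
      have hu' : fderiv ℝ Φ (s, 0) (0, u) = 0 := hu
      refine hnd u fun v => ?_
      have h1 := htransport s hs 0 h0b u v
      rw [hu', map_zero, zero_apply, formPath_apply, hδ0] at h1
      simpa using h1.symm
    let e : E ≃L[ℝ] E := (LinearEquiv.ofInjectiveEndo (A : E →ₗ[ℝ] E) hAinj).toContinuousLinearEquiv
    have he : HasFDerivAt ψ (e : E →L[ℝ] E) 0 := (hψd 0 h0b).congr_fderiv rfl
    obtain ⟨Ψ, hΨ, h0, hΨψ⟩ := hψ.exists_isLocalDiffeo hr he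
    refine ⟨Ψ, hΨ, h0, by rw [hΨψ, hψ0], ?_, ?_⟩
    · filter_upwards [Metric.ball_mem_nhds (0 : E) hρ0] with x hx u v
      rw [hΨψ, (hψd x hx).fderiv]
      exact htransport s hs x hx u v
    · filter_upwards [Metric.ball_mem_nhds (0 : E) hρ0] with x hx
      rw [hΨψ]
      exact or_congr (hmem 0 s hs x hx) (hmem 1 s hs x hx)
  have hsub : Tendsto (fun t : ℝ => t - t₀) (𝓝 t₀) (𝓝 0) := by
    have : Continuous fun t : ℝ => t - t₀ := by fun_prop
    simpa using this.tendsto t₀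
  filter_upwards [hsub.eventually (isOpen_Ioo.mem_nhds h00)] with t ht
  have := hshort _ ht
  rwa [add_sub_cancel] at this

/-- Two symplectic germs which agree at `0` are equivalent by a diffeomorphism preserving two
complementary linear strata on which their rank is maximal. -/
theorem formEquiv_of_eq_at_zero [FiniteDimensional ℝ E] (hr : r = ∞ ∨ r = ω)
    {σ τ : E → E →L[ℝ] E →L[ℝ] ℝ} (hσ : IsClosedGerm r σ) (hτ : IsClosedGerm r τ) (h0 : σ 0 = τ 0)
    (hnd : ∀ u, (∀ v, σ 0 u v = 0) → u = 0)
    {L : Fin 2 → Submodule ℝ E} {P : Fin 2 → E →L[ℝ] E} (hLP : IsStratumPair (σ 0) L P) :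
    FormEquiv r σ (L 0 ∪ L 1) τ (L 0 ∪ L 1) := by
  let δ : E → E →L[ℝ] E →L[ℝ] ℝ := fun x => τ x - σ x
  have hδ : IsClosedGerm r δ := hτ.sub hr hσ
  have hδ0 : δ 0 = 0 := by simp only [δ, h0, sub_self]
  let R : ℝ → ℝ → Prop := fun s t => FormEquiv r (fun x => σ x + s • δ x) (L 0 ∪ L 1)
    (fun x => σ x + t • δ x) (L 0 ∪ L 1)
  have hloc : ∀ t₀, ∀ᶠ t in 𝓝 t₀, R t₀ t :=
    exists_short_time_formEquiv hr hσ hδ hδ0 hnd hLP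
  -- `R` is an equivalence relation with open classes, so each class is also closed, as the
  -- complement of the others.
  have hclopen : IsClopen {t | R 0 t} := by
    refine ⟨⟨isOpen_iff_mem_nhds.2 fun t ht => ?_⟩, isOpen_iff_mem_nhds.2 fun t ht => ?_⟩
    · filter_upwards [hloc t] with s hs
      rw [Set.mem_compl_iff, Set.mem_ofPred_eq] at ht ⊢
      exact fun hs0 => ht (FormEquiv.trans hr hs0 (FormEquiv.symm hr hs))
    · filter_upwards [hloc t] with s hs
      rw [Set.mem_ofPred_eq] at ht
      exact FormEquiv.trans hr ht hs
  have huniv : {t | R 0 t} = Set.univ := hclopen.eq_univ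
    ⟨0, by rw [Set.mem_ofPred_eq]; exact FormEquiv.refl _ _⟩
  have h1 : R 0 1 := by
    have : (1 : ℝ) ∈ {t | R 0 t} := huniv ▸ Set.mem_univ _
    rwa [Set.mem_ofPred_eq] at this
  have e0 : (fun x => σ x + (0 : ℝ) • δ x) = σ := by ext x; simp
  have e1 : (fun x => σ x + (1 : ℝ) • δ x) = τ := by ext x; simp [δ]
  simp only [R] at h1
  rwa [e0, e1] at h1

end ShortTime

/-! ### Passage between alternating forms and bilinear maps -/

section AlternatingForms

variable {E : Type*} [NormedAddCommGroup E] [NormedSpace ℝ E] {r : WithTop ℕ∞}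

variable (E) in
/-- The curried bilinear form of an alternating `2`-form. -/
noncomputable def toBilin : (E [⋀^Fin 2]→L[ℝ] ℝ) →L[ℝ] E →L[ℝ] E →L[ℝ] ℝ :=
  (ContinuousLinearMap.compL ℝ E (E [⋀^Fin 1]→L[ℝ] ℝ) (E →L[ℝ] ℝ)
    (ContinuousAlternatingMap.ofSubsingletonLIE (𝕜 := ℝ) (E := E) (F := ℝ)
      (0 : Fin 1)).symm.toContinuousLinearEquiv.toContinuousLinearMap).comp
    (ContinuousAlternatingMap.curryLeftLI (𝕜 := ℝ) (E := E) (F := ℝ)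
      (n := 1)).toContinuousLinearMap

theorem toBilin_apply (η : E [⋀^Fin 2]→L[ℝ] ℝ) (u v : E) : toBilin E η u v = η ![u, v] := by
  have h : toBilin E η u v = η (Matrix.vecCons u fun _ => v) := rfl
  rw [h]
  congr 1
  ext i; fin_cases i <;> simp

theorem toBilin_neg_swap (η : E [⋀^Fin 2]→L[ℝ] ℝ) (u v : E) :
    toBilin E η u v = -toBilin E η v u := by
  rw [toBilin_apply, toBilin_apply]
  have h : η (![v, u] ∘ Equiv.swap 0 1) = -η ![v, u] :=
    η.map_swap ![v, u] (i := 0) (j := 1) (by simp)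
  rw [← h]
  congr 1
  ext i; fin_cases i <;> simp

theorem toBilin_injective : Function.Injective (toBilin E) := by
  intro η η' h
  ext v
  have hv : v = ![v 0, v 1] := by ext i; fin_cases i <;> rfl
  rw [hv, ← toBilin_apply, ← toBilin_apply, h]

/-- In finite dimension the injective map `toBilin` has a continuous linear left inverse. This
transfers regularity back to alternating forms, as needed to apply the pullback formula for
`extDeriv`. -/
theorem smoothNear_of_toBilin [FiniteDimensional ℝ E] {σ : E → E [⋀^Fin 2]→L[ℝ] ℝ} {a : E}
    (h : SmoothNear r (fun x => toBilin E (σ x)) a) : SmoothNear r σ a := by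
  obtain ⟨K, hK⟩ := (toBilin E).toLinearMap.exists_leftInverse_of_injective
    (LinearMap.ker_eq_bot.2 toBilin_injective)
  have := h.clm K.toContinuousLinearMap
  have e : (fun x => K.toContinuousLinearMap (toBilin E (σ x))) = σ :=
    funext fun x => LinearMap.congr_fun hK (σ x)
  rwa [e] at this

/-- The alternating sum defining `extDeriv` becomes the cyclic sum once the arguments of the middle
term are exchanged. -/
theorem isClosedGerm_toBilin (hr : r = ∞ ∨ r = ω) {σ : E → E [⋀^Fin 2]→L[ℝ] ℝ}
    (hσ : SmoothNear r σ 0) (hd : ∀ᶠ x in 𝓝 0, extDeriv σ x = 0) :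
    IsClosedGerm r fun x => toBilin E (σ x) := by
  have halt : ∀ᶠ x in 𝓝 (0 : E), ∀ u v, toBilin E (σ x) u v = -toBilin E (σ x) v u :=
    Eventually.of_forall fun x u v => toBilin_neg_swap _ u v
  refine ⟨hσ.clm _, halt, ?_⟩
  filter_upwards [hd, hσ.eventually_differentiableAt hr,
    eventually_fderiv_alternating hr (hσ.clm (toBilin E)) halt] with x h1 h2 h3 u v w
  have key : ∀ a b c : E, fderiv ℝ (fun y => σ y ![b, c]) x a =
      fderiv ℝ (fun y => toBilin E (σ y)) x a b c := by
    intro a b c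
    have e : HasFDerivAt (fun y => toBilin E (σ y)) ((toBilin E).comp (fderiv ℝ σ x)) x :=
      (toBilin E).hasFDerivAt.comp x h2.hasFDerivAt
    have e2 := (e.clm_apply (hasFDerivAt_const b x)).clm_apply (hasFDerivAt_const c x)
    simp only [toBilin_apply] at e2
    rw [e2.fderiv, e.fderiv]
    simp
  have h4 := extDeriv_apply h2 ![u, v, w]
  rw [h1, Fin.sum_univ_three] at h4
  have r0 : Fin.removeNth 0 ![u, v, w] = ![v, w] := by ext i; fin_cases i <;> rfl
  have r1 : Fin.removeNth 1 ![u, v, w] = ![u, w] := by ext i; fin_cases i <;> rfl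
  have r2 : Fin.removeNth 2 ![u, v, w] = ![u, v] := by ext i; fin_cases i <;> rfl
  rw [r0, r1, r2, key, key, key] at h4
  simp at h4
  rw [h3 v w u]
  linarith

theorem areDiffeomorphic_of_formEquiv {σ σ' : E → E [⋀^Fin 2]→L[ℝ] ℝ} {N N' : Set E}
    (h : FormEquiv r (fun x => toBilin E (σ x)) N (fun x => toBilin E (σ' x)) N') :
    AreDiffeomorphic r σ N 0 σ' N' 0 := by
  obtain ⟨Ψ, hΨ, h0, hΨ0, hB, hN⟩ := h
  refine ⟨Ψ, hΨ, h0, hΨ0, ?_, hN⟩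
  filter_upwards [hB] with x hx
  apply toBilin_injective
  ext u v
  rw [← hx, toBilin_apply, toBilin_apply, ContinuousAlternatingMap.compContinuousLinearMap_apply]
  congr 1
  ext i; fin_cases i <;> rfl

theorem toBilin_compContinuousLinearMap (η : E [⋀^Fin 2]→L[ℝ] ℝ) (A : E →L[ℝ] E) (u v : E) :
    toBilin E (η.compContinuousLinearMap A) u v = toBilin E η (A u) (A v) := by
  rw [toBilin_apply, toBilin_apply, ContinuousAlternatingMap.compContinuousLinearMap_apply]
  congr 1
  ext i; fin_cases i <;> rfl

/-- A smooth closed `2`-form pulls back to a smooth closed `2`-form. -/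
theorem isClosedGerm_pullback [FiniteDimensional ℝ E] (hr : r = ∞ ∨ r = ω)
    {σ : E → E [⋀^Fin 2]→L[ℝ] ℝ} (hσ : SmoothNear r σ 0) (hd : ∀ᶠ x in 𝓝 0, extDeriv σ x = 0)
    {Θ : E → E} (hΘ : SmoothNear r Θ 0) (h0 : Θ 0 = 0) :
    IsClosedGerm r fun x => toBilin E ((σ (Θ x)).compContinuousLinearMap (fderiv ℝ Θ x)) := by
  have hlim : Tendsto Θ (𝓝 0) (𝓝 0) := by
    have := hΘ.continuousAt.tendsto
    rwa [h0] at this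
  refine isClosedGerm_toBilin hr (smoothNear_of_toBilin ?_) ?_
  · have e : (fun x => toBilin E ((σ (Θ x)).compContinuousLinearMap (fderiv ℝ Θ x))) = fun x =>
        ((ContinuousLinearMap.compL ℝ E E ℝ).flip (fderiv ℝ Θ x)).comp
          ((toBilin E (σ (Θ x))).comp (fderiv ℝ Θ x)) := by
      funext x
      ext u v
      rw [toBilin_compContinuousLinearMap]
      rfl
    rw [e]
    have hσΘ : SmoothNear r (fun x => σ (Θ x)) 0 := hσ.comp_of_eq hΘ h0
    have hD := hΘ.fderiv hr
    exact (hD.clm _).clm_comp ((hσΘ.clm (toBilin E)).clm_comp hD)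
  · filter_upwards [hlim.eventually hd, hlim.eventually (hσ.eventually_differentiableAt hr),
      hΘ] with x h1 h2 h3
    rw [extDeriv_pullback h2 h3 (minSmoothness_le_of_infty_or_omega hr), h1]
    ext v
    simp

end AlternatingForms

/-! ### Maximal rank as a splitting of the tangent space -/

section Rank

variable {E : Type*} [NormedAddCommGroup E] [NormedSpace ℝ E] [FiniteDimensional ℝ E]

/-- A subspace of dimension `k` on which a `2`-form has rank `2[k/2]` splits as a nondegenerate
part and at most one further direction. -/
theorem exists_isMaximalRankSplitting {η : E [⋀^Fin 2]→L[ℝ] ℝ} {T : Submodule ℝ E} {k : ℕ}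
    (hT : Module.finrank ℝ T = k) (hrank : rankOn η T = 2 * (k / 2)) :
    ∃ H, IsMaximalRankSplitting (toBilin E η) T H := by
  set f := (bilin η).domRestrict₁₂ T T with hf
  have hfa : ∀ u v : T, f u v = toBilin E η u v := fun u v => (toBilin_apply η u v).symm
  have hN : Module.finrank ℝ (LinearMap.range f) + Module.finrank ℝ (LinearMap.ker f) = k := by
    rw [f.finrank_range_add_finrank_ker, hT]
  rw [show Module.finrank ℝ (LinearMap.range f) = 2 * (k / 2) from hrank] at hN
  have hker : ∀ u : T, u ∈ LinearMap.ker f ↔ ∀ v ∈ T, toBilin E η u v = 0 := by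
    intro u
    rw [LinearMap.mem_ker]
    constructor
    · intro h v hv
      rw [← hfa u ⟨v, hv⟩, h]
      rfl
    · intro h
      ext v
      rw [hfa, h v v.2]
      rfl
  -- The kernel of the restricted form has dimension `k - 2 * (k / 2)`. In dimension one, `H` is a
  -- complement of the kernel and `e` spans the kernel.
  have hcase : Module.finrank ℝ (LinearMap.ker f) = 0 ∨
      Module.finrank ℝ (LinearMap.ker f) = 1 := by omega
  rcases hcase with h | h
  · refine ⟨T, le_rfl, fun u hu huv => ?_, Or.inl rfl⟩
    have h1 := (hker ⟨u, hu⟩).2 huv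
    rw [Submodule.finrank_eq_zero.1 h, Submodule.mem_bot] at h1
    exact congrArg Subtype.val h1
  · obtain ⟨Q, hQ⟩ := (LinearMap.ker f).exists_isCompl
    obtain ⟨e, he0, he⟩ := finrank_eq_one_iff'.1 h
    have hdecomp : ∀ v ∈ T, ∃ h ∈ Q.map T.subtype, ∃ c : ℝ, v = h + c • (e : T).1 := by
      intro v hv
      have hv' : (⟨v, hv⟩ : T) ∈ Q ⊔ LinearMap.ker f := by
        rw [sup_comm, hQ.sup_eq_top]; trivial
      obtain ⟨q, hq, m, hm, hqm⟩ := Submodule.mem_sup.1 hv'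
      obtain ⟨c, hc⟩ := he ⟨m, hm⟩
      refine ⟨q, ⟨q, hq, rfl⟩, c, ?_⟩
      have h1 := congrArg Subtype.val hqm
      have h2 : c • (e : T) = m := congrArg Subtype.val hc
      rw [← h2] at h1
      exact h1.symm
    have hezero : ∀ v ∈ T, toBilin E η (e : T).1 v = 0 := (hker e).1 e.2
    refine ⟨Q.map T.subtype, Submodule.map_subtype_le T Q, ?_, Or.inr ⟨(e : T).1, (e : T).2, ?_,
      hdecomp, ?_⟩⟩
    · rintro _ ⟨q, hq, rfl⟩ hu
      have h1 : q ∈ LinearMap.ker f := by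
        refine (hker q).2 fun v hv => ?_
        obtain ⟨h, hh, c, rfl⟩ := hdecomp v hv
        have h2 := hu h hh
        rw [map_add, map_smul, toBilin_neg_swap η q (e : T).1, hezero q q.2]
        simpa using h2
      have h3 := hQ.disjoint.le_bot (⟨h1, hq⟩ : q ∈ LinearMap.ker f ⊓ Q)
      rw [Submodule.mem_bot] at h3
      rw [h3]; rfl
    · intro h0
      exact he0 (Subtype.ext (Subtype.ext h0))
    · intro h hh
      exact hezero h (Submodule.map_subtype_le T Q hh)

end Rank

/-! ### Straightening the two submanifolds -/

section Straightening

variable {E : Type*} [NormedAddCommGroup E] [NormedSpace ℝ E] {r : WithTop ℕ∞}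

/-- The map `ι`, tangent to the identity at `0`, carries the subspace `T` onto `S` near `0`, and `κ`
inverts it. -/
structure IsStraightening (r : WithTop ℕ∞) (S : Set E) (T : Submodule ℝ E) (ι κ : E → E) :
    Prop where
  smooth : SmoothNear r ι 0
  map_zero : ι 0 = 0
  hasFDerivAt : HasFDerivAt ι (ContinuousLinearMap.id ℝ E) 0
  symm_map_zero : κ 0 = 0
  symm_hasFDerivAt : HasFDerivAt κ (ContinuousLinearMap.id ℝ E) 0
  mem : ∀ᶠ v in 𝓝 0, v ∈ T → ι v ∈ S
  symm_mem : ∀ᶠ p in 𝓝 0, p ∈ S → κ p ∈ T ∧ ι (κ p) = p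

/-- Normalizing a chart `φ` by its derivative `A` at `0` makes it tangent to the identity: `T` is
the preimage of `F` under `A`, and `φ 0 ∈ F` absorbs the translation. -/
theorem IsSubmanifoldGerm.exists_isStraightening (hr : r = ∞ ∨ r = ω) {k : ℕ} {S : Set E}
    (hS : IsSubmanifoldGerm r k S 0) :
    ∃ (T : Submodule ℝ E) (ι κ : E → E), Module.finrank ℝ T = k ∧ IsStraightening r S T ι κ := by
  obtain ⟨h0S, φ, F, hφ, h0, hF, himg⟩ := hS
  have hc : φ 0 ∈ φ.target := φ.map_source h0
  have hsymm : φ.symm (φ 0) = 0 := φ.left_inv h0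
  have hd := ((hφ.smoothNear h0).differentiableAt hr).hasFDerivAt
  have hd' := ((hφ.symm.smoothNear (a := φ 0) hc).differentiableAt hr).hasFDerivAt
  set A := fderiv ℝ φ 0
  set B := fderiv ℝ φ.symm (φ 0)
  have hBA : B.comp A = ContinuousLinearMap.id ℝ E := by
    have e1 : HasFDerivAt (fun x => φ.symm (φ x)) (B.comp A) 0 := hd'.comp 0 hd
    refine e1.unique ((hasFDerivAt_id (0 : E)).congr_of_eventuallyEq ?_)
    filter_upwards [φ.open_source.mem_nhds h0] with x hx using φ.left_inv hx
  have hAB : A.comp B = ContinuousLinearMap.id ℝ E := by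
    have hd2 : HasFDerivAt φ A (φ.symm (φ 0)) := by rwa [hsymm]
    have e1 : HasFDerivAt (fun x => φ (φ.symm x)) (A.comp B) (φ 0) := hd2.comp _ hd'
    refine e1.unique ((hasFDerivAt_id (φ 0)).congr_of_eventuallyEq ?_)
    filter_upwards [φ.open_target.mem_nhds hc] with x hx using φ.right_inv hx
  have hBA' : ∀ v, B (A v) = v := fun v => congrArg (fun M : E →L[ℝ] E => M v) hBA
  have hAB' : ∀ v, A (B v) = v := fun v => congrArg (fun M : E →L[ℝ] E => M v) hAB
  let e : E ≃L[ℝ] E := ContinuousLinearEquiv.equivOfInverse A B hBA' hAB'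
  have hcF : φ 0 ∈ F := by
    have : φ 0 ∈ φ '' (S ∩ φ.source) := ⟨0, ⟨h0S, h0⟩, rfl⟩
    rw [himg] at this
    exact this.1
  have hshift : HasFDerivAt (fun v => φ 0 + A v) A 0 := A.hasFDerivAt.const_add (φ 0)
  have hshift0 : φ 0 + A 0 = φ 0 := by simp
  refine ⟨F.comap (A : E →ₗ[ℝ] E), fun v => φ.symm (φ 0 + A v), fun p => B (φ p - φ 0), ?_, ?_, ?_,
    ?_, ?_, ?_, ?_, ?_⟩
  · rw [← hF]
    exact (LinearEquiv.ofSubmodule' e.toLinearEquiv F).finrank_eq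
  · exact (hφ.symm.smoothNear (a := φ 0) hc).comp_of_eq
      ((smoothNear_const _ _).add ((smoothNear_id _).clm A)) hshift0
  · simp only [hshift0, hsymm]
  · have hd2 : HasFDerivAt φ.symm B (φ 0 + A 0) := by rwa [hshift0]
    have := hd2.comp (0 : E) hshift
    rw [hBA] at this
    exact this
  · simp
  · have := B.hasFDerivAt.comp (0 : E) (hd.sub_const (φ 0))
    rw [hBA] at this
    exact this
  · have hlim : Tendsto (fun v => φ 0 + A v) (𝓝 0) (𝓝 (φ 0)) := by
      have := hshift.continuousAt.tendsto
      rwa [hshift0] at this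
    filter_upwards [hlim.eventually (φ.open_target.mem_nhds hc)] with v hv hvT
    have h1 : φ 0 + A v ∈ φ '' (S ∩ φ.source) := by
      rw [himg]
      exact ⟨F.add_mem hcF hvT, hv⟩
    obtain ⟨p, ⟨hpS, hp⟩, hpv⟩ := h1
    rwa [← hpv, φ.left_inv hp]
  · filter_upwards [φ.open_source.mem_nhds h0] with p hp hpS
    have h1 : φ p ∈ φ '' (S ∩ φ.source) := ⟨p, ⟨hpS, hp⟩, rfl⟩
    rw [himg] at h1
    constructor
    · rw [Submodule.mem_comap]
      change A (B (φ p - φ 0)) ∈ F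
      rw [hAB']
      exact F.sub_mem h1.1 hcF
    · rw [hAB', add_sub_cancel, φ.left_inv hp]

/-- For a curve in `S` the composite with `κ` runs in the closed subspace `T` and has the same
velocity; conversely `t ↦ ι (t v)` is a curve in `S` with velocity `v ∈ T`. -/
theorem IsStraightening.tangentSpaceOf_eq [FiniteDimensional ℝ E] {S : Set E} {T : Submodule ℝ E}
    {ι κ : E → E} (h : IsStraightening r S T ι κ) : tangentSpaceOf S 0 = T := by
  apply le_antisymm
  · rw [tangentSpaceOf, Submodule.span_le]
    rintro v ⟨γ, hγ0, hγS, hγ⟩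
    have h1 : HasFDerivAt κ (ContinuousLinearMap.id ℝ E) (γ 0) := by
      rw [hγ0]; exact h.symm_hasFDerivAt
    have h2 := h1.comp_hasDerivAt (0 : ℝ) hγ
    have hlim : Tendsto γ (𝓝 0) (𝓝 0) := by
      have := hγ.continuousAt.tendsto
      rwa [hγ0] at this
    refine T.closed_of_finiteDimensional.mem_of_tendsto h2.tendsto_slope_zero ?_
    filter_upwards [nhdsWithin_le_nhds hγS,
      nhdsWithin_le_nhds (hlim.eventually h.symm_mem)] with t ht1 ht2
    refine T.smul_mem _ ?_
    rw [zero_add, Function.comp_apply, Function.comp_apply, hγ0, h.symm_map_zero, sub_zero]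
    exact (ht2 ht1).1
  · intro v hv
    apply Submodule.subset_span
    have h1 : HasDerivAt (fun t : ℝ => t • v) v 0 := by
      simpa using (hasDerivAt_id (0 : ℝ)).smul_const v
    have hlim : Tendsto (fun t : ℝ => t • v) (𝓝 0) (𝓝 0) := by
      have := h1.continuousAt.tendsto
      rwa [zero_smul] at this
    have h2 : HasFDerivAt ι (ContinuousLinearMap.id ℝ E) ((0 : ℝ) • v) := by
      rw [zero_smul]; exact h.hasFDerivAt
    refine ⟨fun t => ι (t • v), by simp only [zero_smul, h.map_zero], ?_, ?_⟩
    · filter_upwards [hlim.eventually h.mem] with t ht using ht (T.smul_mem t hv)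
    · have := h2.comp_hasDerivAt (0 : ℝ) h1
      exact this

/-- Two transversal submanifold germs are straightened simultaneously by a local diffeomorphism
tangent to the identity. -/
theorem exists_simultaneous_straightening [CompleteSpace E] (hr : r = ∞ ∨ r = ω) {S : Fin 2 → Set E}
    {T : Fin 2 → Submodule ℝ E} {ι κ : Fin 2 → E → E} {P : Fin 2 → E →L[ℝ] E}
    (h : ∀ i, IsStraightening r (S i) (T i) (ι i) (κ i)) (hPT : ∀ i, ∀ v ∈ T i, P i v = v)
    (hP0 : ∀ i j, i ≠ j → ∀ v ∈ T j, P i v = 0) :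
    ∃ Ψ : OpenPartialHomeomorph E E, IsLocalDiffeo r Ψ ∧ 0 ∈ Ψ.source ∧ Ψ 0 = 0 ∧
      fderiv ℝ Ψ 0 = ContinuousLinearMap.id ℝ E ∧
      ∀ᶠ x in 𝓝 0, x ∈ (T 0 : Set E) ∪ T 1 ↔ Ψ x ∈ S 0 ∪ S 1 := by
  -- The components in the two subspaces are replaced by their images under the separate
  -- straightenings, so `Θ` agrees with `ι i` on `T i`; the derivative at `0` remains the identity.
  let Θ : E → E := fun x => x - P 0 x - P 1 x + ι 0 (P 0 x) + ι 1 (P 1 x)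
  have hsm : SmoothNear r Θ 0 := by
    have hι : ∀ i, SmoothNear r (fun x => ι i (P i x)) 0 := fun i =>
      (h i).smooth.comp_of_eq ((smoothNear_id _).clm (P i)) (map_zero _)
    exact (((smoothNear_id _).sub ((smoothNear_id _).clm _)).sub
      ((smoothNear_id _).clm _)).add (hι 0) |>.add (hι 1)
  have hder : HasFDerivAt Θ (ContinuousLinearMap.id ℝ E) 0 := by
    have hι : ∀ i, HasFDerivAt (fun x => ι i (P i x)) (P i) 0 := by
      intro i
      have h1 : HasFDerivAt (ι i) (ContinuousLinearMap.id ℝ E) (P i 0) := by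
        rw [map_zero]; exact (h i).hasFDerivAt
      have := h1.comp (0 : E) (P i).hasFDerivAt
      exact this
    have h2 := ((((hasFDerivAt_id (𝕜 := ℝ) (0 : E)).sub (P 0).hasFDerivAt).sub
      (P 1).hasFDerivAt).add (hι 0)).add (hι 1)
    refine h2.congr_fderiv ?_
    abel
  have hΘ : ∀ i, ∀ v ∈ T i, Θ v = ι i v := by
    intro i v hv
    fin_cases i
    · have h1 := hPT 0 v hv
      have h2 := hP0 1 0 (by decide) v hv
      simp [Θ, h1, h2, (h 1).map_zero]
    · have h1 := hPT 1 v hv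
      have h2 := hP0 0 1 (by decide) v hv
      simp [Θ, h1, h2, (h 0).map_zero]
  have hΘ0 : Θ 0 = 0 := by rw [hΘ 0 0 (T 0).zero_mem, (h 0).map_zero]
  obtain ⟨Ψ, hΨ, h0, hΨΘ⟩ := hsm.exists_isLocalDiffeo hr (f' := ContinuousLinearEquiv.refl ℝ E) hder
  have hlim : Tendsto Θ (𝓝 0) (𝓝 0) := by
    have := hder.continuousAt.tendsto
    rwa [hΘ0] at this
  have hmem : ∀ i, ∀ᶠ x in 𝓝 0, x ∈ T i ↔ Θ x ∈ S i := by
    intro i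
    have hκ : Tendsto (κ i) (𝓝 0) (𝓝 0) := by
      have := (h i).symm_hasFDerivAt.continuousAt.tendsto
      rwa [(h i).symm_map_zero] at this
    filter_upwards [(h i).mem, hlim.eventually (h i).symm_mem, Ψ.open_source.mem_nhds h0,
      hlim.eventually (hκ.eventually (Ψ.open_source.mem_nhds h0))] with x h1 h2 h3 h4
    constructor
    · intro hx
      rw [hΘ i x hx]
      exact h1 hx
    · intro hx
      -- A point `Θ x` of `S i` is also the image of `κ i (Θ x) ∈ T i`, so `x` is that point by
      -- local injectivity.
      obtain ⟨h5, h6⟩ := h2 hx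
      have h7 : Ψ (κ i (Θ x)) = Ψ x := by rw [hΨΘ, hΘ i _ h5, h6]
      rwa [← Ψ.injOn h4 h3 h7]
  refine ⟨Ψ, hΨ, h0, by rw [hΨΘ, hΘ0], by rw [hΨΘ, hder.fderiv], ?_⟩
  filter_upwards [hmem 0, hmem 1] with x h1 h2
  rw [hΨΘ, Set.mem_union, Set.mem_union, ← h1, ← h2]
  rfl

/-- Projections onto two independent subspaces, each vanishing on the other one. -/
theorem exists_projections [FiniteDimensional ℝ E] {T : Fin 2 → Submodule ℝ E}
    (hT : Disjoint (T 0) (T 1)) :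
    ∃ P : Fin 2 → E →L[ℝ] E, (∀ i v, P i v ∈ T i) ∧ (∀ i, ∀ v ∈ T i, P i v = v) ∧
      ∀ i j, i ≠ j → ∀ v ∈ T j, P i v = 0 := by
  have key : ∀ U W : Submodule ℝ E, Disjoint U W → ∃ P : E →L[ℝ] E, (∀ v, P v ∈ U) ∧
      (∀ v ∈ U, P v = v) ∧ ∀ v ∈ W, P v = 0 := by
    intro U W hUW
    -- `U` and `W` need not span `E`, so `W` is first enlarged to a complement of `U`.
    obtain ⟨W', hWW', hc⟩ := hUW.symm.exists_isCompl
    exact ⟨(U.projection W' hc.symm).toContinuousLinearMap,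
      Submodule.projection_apply_mem hc.symm,
      fun v hv => Submodule.projection_apply_of_mem_left hc.symm hv,
      fun v hv => (Submodule.projection_apply_eq_zero_iff hc.symm).2 (hWW' hv)⟩
  obtain ⟨P₀, h1, h2, h3⟩ := key _ _ hT
  obtain ⟨P₁, k1, k2, k3⟩ := key _ _ hT.symm
  refine ⟨![P₀, P₁], Fin.forall_fin_two.2 ⟨h1, k1⟩, Fin.forall_fin_two.2 ⟨h2, k2⟩, ?_⟩
  intro i j hij
  fin_cases i <;> fin_cases j
  · exact absurd rfl hij
  · exact h3
  · exact k3
  · exact absurd rfl hij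

end Straightening

/-! ### Assembly of the theorem -/

section Main

variable {E : Type u} [NormedAddCommGroup E] [NormedSpace ℝ E] [FiniteDimensional ℝ E]
  {r : WithTop ℕ∞}

/-- The diffeomorphism is a composition of three equivalences: undo the straightening for σ, apply
the homotopy method to the pulled back forms, and straighten for σ'. -/
theorem areDiffeomorphic_of_eq_at_zero (hr : r = ∞ ∨ r = ω) {k : ℕ}
    {σ σ' : E → E [⋀^Fin 2]→L[ℝ] ℝ} {S : Fin 2 → Set E}
    (hσ : IsSymplecticGerm r σ 0) (hσ' : IsSymplecticGerm r σ' 0)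
    (hS : ∀ i, IsSubmanifoldGerm r k (S i) 0) (hrank : ∀ i, HasMaximalRank k σ (S i) 0)
    (hdisj : tangentSpaceOf (S 0) 0 ⊓ tangentSpaceOf (S 1) 0 = ⊥) (h0 : σ 0 = σ' 0) :
    AreDiffeomorphic r σ (S 0 ∪ S 1) 0 σ' (S 0 ∪ S 1) 0 := by
  choose T ι κ hk hst using fun i => (hS i).exists_isStraightening hr
  rw [(hst 0).tangentSpaceOf_eq, (hst 1).tangentSpaceOf_eq] at hdisj
  obtain ⟨P, hP1, hP2, hP3⟩ := exists_projections (disjoint_iff.2 hdisj)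
  obtain ⟨Ψ, hΨ, h0Ψ, hΨ0, hdΨ, hN⟩ := exists_simultaneous_straightening hr hst hP2 hP3
  have hsplit : ∀ i, ∃ H, IsMaximalRankSplitting (toBilin E (σ 0)) (T i) H := fun i => by
    have h1 := (hrank i).self_of_nhdsWithin (hS i).1
    rw [(hst i).tangentSpaceOf_eq] at h1
    exact exists_isMaximalRankSplitting (hk i) h1
  have hpull : ∀ τ : E → E [⋀^Fin 2]→L[ℝ] ℝ, FormEquiv r
      (fun x => toBilin E ((τ (Ψ x)).compContinuousLinearMap (fderiv ℝ Ψ x)))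
      ((T 0 : Set E) ∪ T 1) (fun x => toBilin E (τ x)) (S 0 ∪ S 1) := fun τ =>
    ⟨Ψ, hΨ, h0Ψ, hΨ0, Eventually.of_forall fun x u v =>
      (toBilin_compContinuousLinearMap _ _ u v).symm, hN⟩
  -- Tangency of `Ψ` to the identity keeps the values of the forms at `0`, so their equality,
  -- nondegeneracy and the rank splittings need not be transported.
  have hval : ∀ τ : E → E [⋀^Fin 2]→L[ℝ] ℝ,
      (τ (Ψ 0)).compContinuousLinearMap (fderiv ℝ Ψ 0) = τ 0 := fun τ => by
    rw [hΨ0, hdΨ]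
    ext v
    rfl
  have hmid := formEquiv_of_eq_at_zero hr (L := T) (P := P)
    (isClosedGerm_pullback hr hσ.contDiff hσ.closed (hΨ.smoothNear h0Ψ) hΨ0)
    (isClosedGerm_pullback hr hσ'.contDiff hσ'.closed (hΨ.smoothNear h0Ψ) hΨ0)
    (by rw [hval, hval, h0])
    (by
      rw [hval]
      intro u hu
      exact hσ.nondegenerate.self_of_nhds.1 u fun v => by rw [← hu v, toBilin_apply]; rfl)
    (by rw [hval]; exact ⟨hP1, hP2, hP3, hsplit⟩)
  exact areDiffeomorphic_of_formEquiv (((hpull σ).symm hr).trans hr (hmid.trans hr (hpull σ')))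

end Main

end SymplecticTuple

theorem theorem6p1 (r : WithTop ℕ∞) (hr : r = ∞ ∨ r = ω)
    (n k : ℕ) (hk : 1 ≤ k) (hkn : k ≤ n)
    (σ σ' : EuclideanSpace ℝ (Fin (2 * n)) → EuclideanSpace ℝ (Fin (2 * n)) [⋀^Fin 2]→L[ℝ] ℝ)
    (S₁ S₂ : Set (EuclideanSpace ℝ (Fin (2 * n))))
    (hσ : SymplecticTuple.IsSymplecticGerm r σ 0)
    (hσ' : SymplecticTuple.IsSymplecticGerm r σ' 0)
    (hS₁ : SymplecticTuple.IsSubmanifoldGerm r k S₁ 0)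
    (hS₂ : SymplecticTuple.IsSubmanifoldGerm r k S₂ 0)
    (hG1₁ : SymplecticTuple.HasMaximalRank k σ S₁ 0)
    (hG1₂ : SymplecticTuple.HasMaximalRank k σ S₂ 0)
    (hG1₁' : SymplecticTuple.HasMaximalRank k σ' S₁ 0)
    (hG1₂' : SymplecticTuple.HasMaximalRank k σ' S₂ 0)
    (hG2 : SymplecticTuple.IsRegularCouple n k S₁ S₂ 0)
    (h0 : σ 0 = σ' 0) :
    SymplecticTuple.AreDiffeomorphic r σ (S₁ ∪ S₂) 0 σ' (S₁ ∪ S₂) 0 :=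
  SymplecticTuple.areDiffeomorphic_of_eq_at_zero hr (S := ![S₁, S₂]) hσ hσ'
    (Fin.forall_fin_two.2 ⟨hS₁, hS₂⟩) (Fin.forall_fin_two.2 ⟨hG1₁, hG1₂⟩) (hG2.1 hkn) h0
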